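/- Let $n\ge 1$ and $k\ge 2$ be integers with $k\mid n$, put $C=\binom{n-1}{k-1}$, and let $\sigma\in(0,1)$. Let $A_0,A_1,\dots,A_m$ be real symmetric $n\times n$ matrices, $b\in\mathbb R^m$, and consider the semidefinite program $\inf\{\langle A_0,X\rangle:\ \langle A_i,X\rangle=b_i\ (i=1,\dots,m),\ X\succeq 0\}$, where $\langle X,Y\rangle=\operatorname{tr}(XY)$. **Notation.** Let $f^{\mathrm{SDP}}(X)=-\log\det X$. The central path consists of the minimizers of $\eta\langle A_0,X\rangle+f^{\mathrm{SDP}}(X)$ over $\{X\succ0:\langle A_i,X\rangle=b_i\ \forall i\ge 1\}$, $\eta>0$. For $v\in\mathbb R$ let $L(v)$ be the set of symmetric $X$ with $\langle A_0,X\rangle=v$ and $\langle A_i,X\rangle=b_i$ for $i\ge1$. For collections $\mathcal Y=(Y_J)$ of symmetric $k\times k$ matrices indexed by the $k$-subsets $J$ of $\{1,\dots,n\}$ let $\Psi(\mathcal Y)=\sum_J Y_J^{\to n}$, where $Y_J^{\to n}$ is the $n\times n$ matrix with principal submatrix $Y_J$ on $J$ and zeros elsewhere; let $f^{\mathrm{FW}(k)}(\mathcal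 Y)=-\sum_J\log\det Y_J$ and let $\mathcal Y_0$ have all blocks equal to $C^{-1}I$, so that $\Psi(\mathcal Y_0)=I$. For symmetric $X$ let $\Psi^\dagger(X)_J$ be $X_{J,J}$ with diagonal entries divided by $C$ and off-diagonal entries divided by $\binom{n-2}{k-2}$. Given $X\succ0$, the rescaled data are $X^{1/2}A_iX^{1/2}$ ($0\le i\le m$); $L_X(v)$ is the space $L(v)$ formed with the rescaled data, and $L^\Psi_X(v)=\{\mathcal Y:\Psi(\mathcal Y)\in L_X(v)\}$. For a function $f$ with gradient $g$ and positive definite Hessian $H$, the Newton step at $x$ of the restriction $f_{|L}$ to an affine space $L$ is the projection of $-H(x)^{-1}g(x)$ onto the direction space of $L$, orthogonal with respect to $\langle u,w\rangle_x=\langle u,H(x)w\rangle$, and the Newton decrement $\Delta(f_{|L},x)$ is its norm $\|\cdot\|_x$. **Predictor step.** From $X_1\succ0$: with $A_i'=X_1^{1/2}A_iX_1^{1/2}$, let $y$ solve $\sum_{j}\langle A_i',A_j'\rangle y_j=\langle A_i',A_0'\rangle$ ($1\le i\le m$), let $\mathcal Z=\Psi^\dagger\bigl(\sum_j y_jA_j'-A_0'\bigr)$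 and $s^*=\sup\{s:\mathcal Y_0+s\mathcal Z\text{ has positive semidefinite blocks}\}$; the result is $X_2=X_1^{1/2}\,\Psi(\mathcal Y_0+\sigma s^*\mathcal Z)\,X_1^{1/2}$ (and $X_2=X_1$ if $\mathcal Z=0$). **Corrector phase.** With $v_2=\langle A_0,X_2\rangle$, start from the state $(X,\mathcal Y)=(X_2,\mathcal Y_0)$. While $\Delta(f^{\mathrm{FW}(k)}_{|L^\Psi_X(v_2)},\mathcal Y)>\frac1{14}$ one may perform a line search, which replaces $\mathcal Y$ by an exact minimizer of $f^{\mathrm{FW}(k)}$, over collections with positive definite blocks, on the line through $\mathcal Y$ along the Newton step of $f^{\mathrm{FW}(k)}_{|L^\Psi_X(v_2)}$. At any time one may rescale, replacing $(X,\mathcal Y)$ by $(X^{1/2}\Psi(\mathcal Y)X^{1/2},\mathcal Y_0)$. The next predictor step may be taken from $X$ when $\Delta(f^{\mathrm{FW}(k)}_{|L^\Psi_X(v_2)},\mathcal Y_0)\le\frac1{14}$. **Lemma.** Let $X_1\succ0$ satisfy $\langle A_i,X_1\rangle=b_i$ for $i\ge1$, put $v_1=\langle A_0,X_1\rangle$,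 and suppose that the central path contains a point $z(v_1)$ with objective value $v_1$ and that $\Delta(f^{\mathrm{SDP}}_{|L(v_1)},X_1)\le\frac19$. Let $X_2$ be the result of the predictor step from $X_1$, let $v_2=\langle A_0,X_2\rangle$, and let $$K=\left\lceil 2688\,C\left(n\log\frac1{1-\sigma}+\frac1{154}\right)\right\rceil .$$ Then: 1. The central path contains a point $z(v_2)$ with objective value $v_2$. 2. However the rescalings are placed, a corrector phase started at $X_2$ makes at most $K$ line searches in total. In each of its states $(X,\mathcal Y)$ the matrix $X$ is positive definite with $\langle A_i,X\rangle=b_i$ for $i\ge1$ and $\langle A_0,X\rangle=v_2$; if $\Delta(f^{\mathrm{FW}(k)}_{|L^\Psi_X(v_2)},\mathcal Y)>\frac1{14}$, then a line search from $\mathcal Y$ exists; and if $\Delta(f^{\mathrm{FW}(k)}_{|L^\Psi_X(v_2)},\mathcal Y_0)\le\frac1{14}$, then $\Delta(f^{\mathrm{SDP}}_{|L(v_2)},X)\le\frac19$ and $\Delta(f^{\mathrm{SDP}}_{|L_X(v_2)},I)\le\frac19$. 3. Consequently, within at most $K$ line searches a corrector phase can reach a state $(X,\mathcal Y_0)$ with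 $\Delta(f^{\mathrm{FW}(k)}_{|L^\Psi_X(v_2)},\mathcal Y_0)\le\frac1{14}$ and $\Delta(f^{\mathrm{SDP}}_{|L(v_2)},X)\le\frac19$, from which the next predictor step can be taken. -/

import Mathlib

open scoped MatrixOrder

noncomputable section

namespace FactorWidth

/-! ### Newton steps and Newton decrements of restricted functionals -/

section Newton

variable {E : Type*} [AddCommGroup E] [Module ℝ E]

/-- The second derivative `D²f(x)[u, w] = ⟨u, H(x) w⟩`, as an iterated directional derivative.
For a twice continuously differentiable `f` this is the Hessian form, i.e. the local inner
product `⟨u, w⟩_x`; no reference norm on `E` is needed. -/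
def hess (f : E → ℝ) (x u w : E) : ℝ :=
  lineDeriv ℝ (fun y => lineDeriv ℝ f y w) x u

/-- `s` is the Newton step at `x` of `f` restricted to the affine subspace `L`: it lies in the
direction of `L` and satisfies `⟨s, d⟩_x = -⟨g(x), d⟩` for all `d` in that direction. In other
words `s` is the `⟨·,·⟩_x`-orthogonal projection of `-H(x)⁻¹ g(x)` onto the direction of `L`. -/
def IsNewtonStep (f : E → ℝ) (L : AffineSubspace ℝ E) (x s : E) : Prop :=
  s ∈ L.direction ∧ ∀ d ∈ L.direction, hess f x s d = -lineDeriv ℝ f x d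

open Classical in
/-- The Newton step of `f` restricted to `L` (it exists and is unique where the Hessian form is
positive definite on the direction of `L`). -/
def newtonStep (f : E → ℝ) (L : AffineSubspace ℝ E) (x : E) : E :=
  if h : ∃ s, IsNewtonStep f L x s then h.choose else 0

/-- The Newton decrement `Δ(f|_L, x)`: the local norm at `x` of the restricted Newton step. -/
def newtonDecrement (f : E → ℝ) (L : AffineSubspace ℝ E) (x : E) : ℝ :=
  Real.sqrt (hess f x (newtonStep f L x) (newtonStep f L x))

end Newton

/-! ### The semidefinite program and its central path -/

/-- Real `n × n` matrices. -/
abbrev Mat (n : ℕ) : Type := Matrix (Fin n) (Fin n) ℝ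

/-- The trace inner product `⟨X, Y⟩ = tr (X Y)`. -/
def ip {n : ℕ} (X Y : Mat n) : ℝ := (X * Y).trace

/-- The barrier `f^SDP(X) = -log det X`. -/
def fSDP {n : ℕ} (X : Mat n) : ℝ := -Real.log X.det

/-- The affine subspace `L(v)` of symmetric matrices `X` with `⟨A₀, X⟩ = v` and
`⟨A i, X⟩ = b i` for all `i`. -/
def slice {n m : ℕ} (A₀ : Mat n) (A : Fin m → Mat n) (b : Fin m → ℝ) (v : ℝ) :
    AffineSubspace ℝ (Mat n) where
  carrier := {X | X.IsSymm ∧ ip A₀ X = v ∧ ∀ i, ip (A i) X = b i}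
  smul_vsub_vadd_mem' := by
    rintro c X Y Z ⟨hX, hX0, hX'⟩ ⟨hY, hY0, hY'⟩ ⟨hZ, hZ0, hZ'⟩
    refine ⟨((hX.sub hY).smul c).add hZ, ?_, fun i => ?_⟩
    · simp only [ip, vsub_eq_sub, vadd_eq_add, mul_add, mul_sub, Matrix.mul_smul,
        Matrix.trace_add, Matrix.trace_sub, Matrix.trace_smul] at *
      simp [hX0, hY0, hZ0]
    · simp only [ip, vsub_eq_sub, vadd_eq_add, mul_add, mul_sub, Matrix.mul_smul,
        Matrix.trace_add, Matrix.trace_sub, Matrix.trace_smul] at *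
      simp [hX' i, hY' i, hZ' i]

/-- `X` is strictly feasible: positive definite with `⟨A i, X⟩ = b i` for all `i`. -/
def StrictlyFeasible {n m : ℕ} (A : Fin m → Mat n) (b : Fin m → ℝ) (X : Mat n) : Prop :=
  X.PosDef ∧ ∀ i, ip (A i) X = b i

/-- `z` is the point with parameter `η` on the central path of
`inf {⟨A₀, X⟩ : ⟨A i, X⟩ = b i, X ⪰ 0}`. -/
def IsCentralPoint {n m : ℕ} (A₀ : Mat n) (A : Fin m → Mat n) (b : Fin m → ℝ)
    (η : ℝ) (z : Mat n) : Prop :=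
  0 < η ∧ StrictlyFeasible A b z ∧
    ∀ X, StrictlyFeasible A b X → η * ip A₀ z + fSDP z ≤ η * ip A₀ X + fSDP X

/-- `B` rescaled with respect to `X`: the matrix `X^{1/2} B X^{1/2}`. -/
def rescale {n : ℕ} (X B : Mat n) : Mat n := CFC.sqrt X * B * CFC.sqrt X

/-! ### Collections of `k × k` blocks -/

/-- The index set of the blocks: `k`-element subsets of `{1, …, n}`. -/
abbrev Idx (n k : ℕ) : Type := {J : Finset (Fin n) // J.card = k}

/-- Collections `𝒴 = (Y_J)` of `k × k` matrices, one for each `J`. -/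
abbrev Blocks (n k : ℕ) : Type := Idx n k → Matrix (Fin k) (Fin k) ℝ

/-- The `n × n` matrix `S_J^{→n}` with `S` as principal submatrix on `J` and zeros elsewhere. -/
def embed {n k : ℕ} (J : Idx n k) (S : Matrix (Fin k) (Fin k) ℝ) : Mat n :=
  fun i j => ∑ p, ∑ q,
    if i = J.1.orderEmbOfFin J.2 p ∧ j = J.1.orderEmbOfFin J.2 q then S p q else 0

/-- `Ψ(𝒴) = ∑_J Y_J^{→n}`. -/
def Psi {n k : ℕ} (Y : Blocks n k) : Mat n := ∑ J, embed J (Y J)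

/-- The right inverse `Ψ†` of `Ψ`: on the block `J` it divides the diagonal entries of `X_{J,J}`
by `C(n-1, k-1)` and the off-diagonal ones by `C(n-2, k-2)`. -/
def PsiDagger {n k : ℕ} (X : Mat n) : Blocks n k := fun J p q =>
  (if p = q then 1 / ((n - 1).choose (k - 1) : ℝ) else 1 / ((n - 2).choose (k - 2) : ℝ)) *
    X (J.1.orderEmbOfFin J.2 p) (J.1.orderEmbOfFin J.2 q)

/-- The collection `𝒴₀`, all of whose blocks are `C(n-1, k-1)⁻¹ I`. -/
def Y0 (n k : ℕ) : Blocks n k := fun _ => (1 / ((n - 1).choose (k - 1) : ℝ)) • 1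

/-- All blocks are positive definite: the interior of the product cone. -/
def BlocksPosDef {n k : ℕ} (Y : Blocks n k) : Prop := ∀ J, (Y J).PosDef

/-- All blocks are positive semidefinite: the product cone. -/
def BlocksPosSemidef {n k : ℕ} (Y : Blocks n k) : Prop := ∀ J, (Y J).PosSemidef

/-- The barrier `f^{FW(k)}(𝒴) = -∑_J log det Y_J`. -/
def fFW {n k : ℕ} (Y : Blocks n k) : ℝ := -∑ J, Real.log (Y J).det

/-- `Ψ` respects the affine combinations needed for `blockSlice`. -/
theorem Psi_smul_sub_add {n k : ℕ} (c : ℝ) (X Y Z : Blocks n k) :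
    Psi (c • (X - Y) + Z) = c • (Psi X - Psi Y) + Psi Z := by
  ext i j
  simp only [Psi, embed, Matrix.sum_apply, Matrix.add_apply, Matrix.smul_apply, Matrix.sub_apply,
    Pi.add_apply, Pi.smul_apply, Pi.sub_apply, smul_eq_mul, ← Finset.sum_sub_distrib,
    Finset.mul_sum, ← Finset.sum_add_distrib]
  refine Finset.sum_congr rfl fun J _ => Finset.sum_congr rfl fun p _ =>
    Finset.sum_congr rfl fun q _ => ?_
  split_ifs <;> ring

/-- The affine subspace `L^Ψ(v)` of collections `𝒴` of symmetric blocks such that `Ψ(𝒴)` lies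
in `L(v)`. -/
def blockSlice {n m : ℕ} (k : ℕ) (A₀ : Mat n) (A : Fin m → Mat n) (b : Fin m → ℝ) (v : ℝ) :
    AffineSubspace ℝ (Blocks n k) where
  carrier := {Y | (∀ J, (Y J).IsSymm) ∧ ip A₀ (Psi Y) = v ∧ ∀ i, ip (A i) (Psi Y) = b i}
  smul_vsub_vadd_mem' := by
    rintro c X Y Z ⟨hX, hX0, hX'⟩ ⟨hY, hY0, hY'⟩ ⟨hZ, hZ0, hZ'⟩
    refine ⟨fun J => (((hX J).sub (hY J)).smul c).add (hZ J), ?_, fun i => ?_⟩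
    · simp only [ip, vsub_eq_sub, vadd_eq_add, Psi_smul_sub_add, mul_add, mul_sub,
        Matrix.mul_smul, Matrix.trace_add, Matrix.trace_sub, Matrix.trace_smul] at *
      simp [hX0, hY0, hZ0]
    · simp only [ip, vsub_eq_sub, vadd_eq_add, Psi_smul_sub_add, mul_add, mul_sub,
        Matrix.mul_smul, Matrix.trace_add, Matrix.trace_sub, Matrix.trace_smul] at *
      simp [hX' i, hY' i, hZ' i]

/-! ### The two phases of the algorithm -/

/-- The space `L_ℓ(v)` for the data rescaled with respect to `X = X_ℓ`. -/
def sliceAt {n m : ℕ} (A₀ : Mat n) (A : Fin m → Mat n) (b : Fin m → ℝ) (v : ℝ) (X : Mat n) :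
    AffineSubspace ℝ (Mat n) :=
  slice (rescale X A₀) (fun i => rescale X (A i)) b v

/-- The space `L_ℓ^Ψ(v)` for the data rescaled with respect to `X = X_ℓ`. -/
def blockSliceAt {n m : ℕ} (k : ℕ) (A₀ : Mat n) (A : Fin m → Mat n) (b : Fin m → ℝ) (v : ℝ)
    (X : Mat n) : AffineSubspace ℝ (Blocks n k) :=
  blockSlice k (rescale X A₀) (fun i => rescale X (A i)) b v

/-- One predictor step with parameter `σ` takes `X` to `X'`. With the data rescaled with respect
to `X`, `y` solves `𝒜 A₀ = 𝒜 𝒜* y`, so that `𝒜* y - A₀` is minus the projection of `A₀` onto the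
null space of `𝒜`; the step from `𝒴₀` in the direction `𝒵 = Ψ†(𝒜* y - A₀)` covers the
fraction `σ` of the distance `s* = sup {s : 𝒴₀ + s 𝒵 ⪰ 0}` to the boundary of the product cone.
(If `𝒵 = 0`, the value of `s*` is immaterial and `X' = X`.) -/
def IsPredictorStep {n m : ℕ} (k : ℕ) (A₀ : Mat n) (A : Fin m → Mat n) (σ : ℝ)
    (X X' : Mat n) : Prop :=
  ∃ y : Fin m → ℝ,
    (∀ i, ip (rescale X (A i)) (∑ j, y j • rescale X (A j)) =
      ip (rescale X (A i)) (rescale X A₀)) ∧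
    let Z : Blocks n k := PsiDagger (∑ j, y j • rescale X (A j) - rescale X A₀)
    X' = rescale X (Psi (Y0 n k + (σ * sSup {s : ℝ | BlocksPosSemidef (Y0 n k + s • Z)}) • Z))

/-- `Y'` is obtained from `Y` by an exact line search for the barrier `f^{FW(k)}` along the
Newton step of its restriction to `L`. -/
def IsLineSearch {n k : ℕ} (L : AffineSubspace ℝ (Blocks n k)) (Y Y' : Blocks n k) : Prop :=
  ∃ t : ℝ, Y' = Y + t • newtonStep fFW L Y ∧ BlocksPosDef Y' ∧
    ∀ s : ℝ, BlocksPosDef (Y + s • newtonStep fFW L Y) →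
      fFW Y' ≤ fFW (Y + s • newtonStep fFW L Y)

/-- The states `(X, 𝒴)` that a corrector phase started at `X₂` with objective value `v` can reach,
together with the number `N` of line searches made so far. Here `X` is the matrix with respect to
which the data are currently rescaled and `𝒴` is the current point of the product cone. A line
search is made only while the Newton decrement of the restricted barrier `f^{FW(k)}` at `𝒴` exceeds
`1/14`; rescaling replaces `X` by `X^{1/2} Ψ(𝒴) X^{1/2}` and restarts from `𝒴₀`. When
to rescale is left open, so that both rescaling after each line search and rescaling only once the
decrement has dropped to `1/14` are covered. -/
inductive CorrectorRun {n m : ℕ} (k : ℕ) (A₀ : Mat n) (A : Fin m → Mat n) (b : Fin m → ℝ)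
    (v : ℝ) (X₂ : Mat n) : Mat n → Blocks n k → ℕ → Prop
  | start : CorrectorRun k A₀ A b v X₂ X₂ (Y0 n k) 0
  | lineSearch {X : Mat n} {Y Y' : Blocks n k} {N : ℕ} :
      CorrectorRun k A₀ A b v X₂ X Y N →
      1 / 14 < newtonDecrement fFW (blockSliceAt k A₀ A b v X) Y →
      IsLineSearch (blockSliceAt k A₀ A b v X) Y Y' →
      CorrectorRun k A₀ A b v X₂ X Y' (N + 1)
  | rescaling {X : Mat n} {Y : Blocks n k} {N : ℕ} :
      CorrectorRun k A₀ A b v X₂ X Y N →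
      CorrectorRun k A₀ A b v X₂ (rescale X (Psi Y)) (Y0 n k) N

end FactorWidth

end

noncomputable section

namespace FactorWidth

open Matrix

/-! ### Trace inner product and log-determinant inequalities. -/

section MatrixFacts

variable {n : ℕ}

/-! The count of line searches rests on the potential `C * fSDP X + fFW Y - fFW (Y0 n k)`, where `C`
is the binomial coefficient `(n-1).choose (k-1)`. A line search lowers it by at least 1/800: while
the decrement exceeds 1/14, a damped Newton step already gains that much (`exists_decrease`), and
the exact search does no worse. A rescaling does not raise it, by `fSDP_Psi_le`. That inequality
comes from averaging: the block-diagonal matrices built from the partitions of the index set into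
`k`-sets have mean `C⁻¹ • Psi Y`, and `log det` is concave.

Rescaling once more turns the potential into `C * fSDP X`. A central point `z` minimizes `fSDP` over
all strictly feasible matrices of no larger objective value, so `z(v₁)` itself serves as the lower
bound at `v₂ ≤ v₁`. Hence the number of searches is at most `800 * C * (fSDP X₂ - fSDP z)`
(`CorrectorRun.count_le`). The gap splits in two: a decrement of at most 1/9 gives at most 1/81 at
`X₁` (`fSDP_sub_le`), and the predictor adds at most `n * log (1 / (1 - σ))`, since its result is a
rescaled `(1 - σ) • 1` plus a positive semidefinite matrix (`predictor_spec`).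

The central point at `v₂` is the determinant maximizer on its slice, which is bounded because
`z(v₁)⁻¹` has constant inner product with the slice (`exists_isCentralPoint`). The same boundedness
makes line searches exist. Finally, pulling a matrix direction back by `PsiDagger` shows that the
block decrement at `Y0` dominates the matrix decrement (`ip_self_le_newtonDecrement_sq`). -/

theorem isHermitian_of_isSymm {S : Mat n} (hS : S.IsSymm) : S.IsHermitian := by
  rw [Matrix.IsHermitian, Matrix.conjTranspose_eq_transpose_of_trivial]; exact hS

theorem isSymm_of_isHermitian {S : Mat n} (hS : S.IsHermitian) : S.IsSymm := by
  rw [Matrix.IsHermitian, Matrix.conjTranspose_eq_transpose_of_trivial] at hS; exact hS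

/-- The trace inner product of a symmetric matrix with itself is a sum of squares. -/
theorem ip_self_eq_sum {S : Mat n} (hS : S.IsSymm) : ip S S = ∑ i, ∑ j, S i j ^ 2 := by
  simp only [ip, Matrix.trace, Matrix.diag, Matrix.mul_apply]
  refine Finset.sum_congr rfl fun i _ => Finset.sum_congr rfl fun j _ => ?_
  rw [hS.apply, sq]

theorem ip_self_nonneg {S : Mat n} (hS : S.IsSymm) : 0 ≤ ip S S := by
  rw [ip_self_eq_sum hS]; positivity

theorem eq_zero_of_ip_self_eq_zero {S : Mat n} (hS : S.IsSymm) (h : ip S S = 0) : S = 0 := by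
  rw [ip_self_eq_sum hS] at h
  ext i j
  have h1 := (Finset.sum_eq_zero_iff_of_nonneg (fun i _ => by positivity)).1 h i (Finset.mem_univ _)
  have h2 := (Finset.sum_eq_zero_iff_of_nonneg (fun i _ => by positivity)).1 h1 j
    (Finset.mem_univ _)
  simpa using h2

theorem ip_comm (X Y : Mat n) : ip X Y = ip Y X := Matrix.trace_mul_comm _ _

theorem ip_add (X Y Z : Mat n) : ip X (Y + Z) = ip X Y + ip X Z := by
  simp [ip, mul_add]

theorem ip_sub (X Y Z : Mat n) : ip X (Y - Z) = ip X Y - ip X Z := by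
  simp [ip, mul_sub]

theorem ip_smul (c : ℝ) (X Y : Mat n) : ip X (c • Y) = c * ip X Y := by
  simp [ip]

theorem ip_zero (X : Mat n) : ip X 0 = 0 := by simp [ip]

theorem ip_one_left (X : Mat n) : ip 1 X = X.trace := by simp [ip]

/-- Diagonalization turns spectral sums into sums over the eigenvalues. -/
theorem ip_self_eq_sum_eigenvalues {S : Mat n} (hS : S.IsHermitian) :
    ip S S = ∑ i, hS.eigenvalues i ^ 2 := by
  have h := hS.spectral_theorem
  set U := hS.eigenvectorUnitary
  have hU : (star (U : Mat n)) * (U : Mat n) = 1 := Unitary.coe_star_mul_self U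
  have hS' : S = (U : Mat n) * diagonal (hS.eigenvalues) * star (U : Mat n) := by
    conv_lhs => rw [h]
    rfl
  rw [ip]
  calc (S * S).trace
      = ((U : Mat n) * diagonal (hS.eigenvalues) * (star (U : Mat n) * (U : Mat n)) *
          diagonal (hS.eigenvalues) * star (U : Mat n)).trace := by
        conv_lhs => rw [hS']
        simp only [Matrix.mul_assoc]
    _ = ((star (U : Mat n) * (U : Mat n)) * (diagonal (hS.eigenvalues) *
          diagonal (hS.eigenvalues))).trace := by
        rw [Matrix.trace_mul_comm]
        simp only [hU, Matrix.mul_one, Matrix.mul_assoc]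
        rw [← Matrix.mul_assoc (star (U : Mat n)), hU]
    _ = _ := by rw [hU, Matrix.one_mul, diagonal_mul_diagonal, trace_diagonal]; simp [sq]

theorem trace_eq_sum_real_eigenvalues {S : Mat n} (hS : S.IsHermitian) :
    S.trace = ∑ i, hS.eigenvalues i := by
  simpa using hS.trace_eq_sum_eigenvalues

theorem log_det_le_trace_sub {P : Mat n} (hP : P.PosDef) : Real.log P.det ≤ P.trace - n := by
  have h1 : P.det = ∏ i, hP.1.eigenvalues i := by simpa using hP.1.det_eq_prod_eigenvalues
  rw [h1, Real.log_prod fun i _ => (hP.eigenvalues_pos i).ne', trace_eq_sum_real_eigenvalues hP.1]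
  calc ∑ i, Real.log (hP.1.eigenvalues i) ≤ ∑ i, (hP.1.eigenvalues i - 1) :=
        Finset.sum_le_sum fun i _ => Real.log_le_sub_one_of_pos (hP.eigenvalues_pos i)
    _ = _ := by simp

theorem sub_sq_le_log_one_add {x : ℝ} (hx : |x| ≤ 1 / 2) : x - x ^ 2 ≤ Real.log (1 + x) := by
  obtain ⟨h1, h2⟩ := abs_le.1 hx
  have h := Real.one_sub_inv_le_log_of_pos (show 0 < 1 + x by linarith)
  by_cases h0 : 0 ≤ x
  · refine le_trans ?_ h
    rw [← sub_nonneg]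
    have : 1 - (1 + x)⁻¹ - (x - x ^ 2) = x ^ 3 / (1 + x) := by
      field_simp
      ring
    rw [this]; positivity
  -- For negative `x` the bound `1 - 1/(1+x)` is too weak; the exponential form with the quadratic
  -- lower bound on `exp` is used instead.
  · have hs : 0 ≤ -(x - x ^ 2) := by nlinarith
    have h3 := Real.quadratic_le_exp_of_nonneg hs
    rw [Real.le_log_iff_exp_le (by linarith), ← neg_neg (x - x ^ 2), Real.exp_neg,
      inv_le_comm₀ (Real.exp_pos _) (by linarith)]
    refine le_trans ?_ h3
    rw [inv_le_iff_one_le_mul₀ (by linarith)]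
    have h6 : 0 ≤ x ^ 2 * (1 + x) := mul_nonneg (sq_nonneg _) (by linarith)
    have h7 : 0 ≤ x ^ 2 * (x + x ^ 2 - x ^ 3 + 1 + x) := by
      apply mul_nonneg (sq_nonneg _); nlinarith [mul_nonneg (sq_nonneg x) (by linarith : 0 ≤ -x)]
    nlinarith [mul_nonneg (sq_nonneg x) (by linarith : (0:ℝ) ≤ -x)]

/-- Cauchy–Schwarz, applied to the rows of `S` and then to `x` and `S x`, bounds the quadratic form
of `S` by half of that of the identity. -/
theorem posDef_one_add {S : Mat n} (hS : S.IsSymm) (h : ip S S ≤ 1 / 4) : (1 + S).PosDef := by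
  have hS' := isHermitian_of_isSymm hS
  refine Matrix.PosDef.of_dotProduct_mulVec_pos (Matrix.isHermitian_one.add hS') fun x hx => ?_
  set q : ℝ := ∑ i, x i ^ 2 with hq
  have hq0 : 0 < q := by
    obtain ⟨i, hi⟩ := Function.ne_iff.1 hx
    exact Finset.sum_pos' (fun i _ => sq_nonneg _) 
      ⟨i, Finset.mem_univ _, sq_pos_of_ne_zero hi⟩
  have hcs : (∑ i, x i * (S *ᵥ x) i) ^ 2 ≤ q * (q * ip S S) := by
    refine (Finset.sum_mul_sq_le_sq_mul_sq _ _ _).trans ?_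
    refine mul_le_mul_of_nonneg_left ?_ hq0.le
    rw [ip_self_eq_sum hS, Finset.mul_sum]
    refine Finset.sum_le_sum fun i _ => ?_
    rw [mul_comm]
    exact Finset.sum_mul_sq_le_sq_mul_sq Finset.univ (fun j => S i j) x
  have hval : star x ⬝ᵥ (1 + S) *ᵥ x = q + ∑ i, x i * (S *ᵥ x) i := by
    rw [Matrix.add_mulVec, Matrix.one_mulVec, dotProduct_add]
    simp [dotProduct, hq, sq]
  rw [hval]
  have h2 : (∑ i, x i * (S *ᵥ x) i) ^ 2 ≤ (q / 2) ^ 2 := by nlinarith [mul_pos hq0 hq0]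
  have := (abs_le.1 (abs_le_of_sq_le_sq h2 (by positivity))).1
  linarith

/-- The Frobenius bound puts every eigenvalue of `1 + S` within 1/2 of 1, so the scalar estimate
`sub_sq_le_log_one_add` applies to each and the results add up. -/
theorem log_det_one_add {S : Mat n} (hS : S.IsSymm) (h : ip S S ≤ 1 / 4) :
    S.trace - ip S S ≤ Real.log (1 + S).det := by
  have hP := posDef_one_add hS h
  set μ := hP.1.eigenvalues with hμ
  have h1 : (1 + S).det = ∏ i, μ i := by simpa using hP.1.det_eq_prod_eigenvalues
  have h2 : (n : ℝ) + S.trace = ∑ i, μ i := by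
    rw [← trace_eq_sum_real_eigenvalues hP.1, Matrix.trace_add]; simp
  have h3 : (n : ℝ) + 2 * S.trace + ip S S = ∑ i, μ i ^ 2 := by
    rw [← ip_self_eq_sum_eigenvalues hP.1, ip, ip, mul_add, add_mul, add_mul]
    simp [Matrix.trace_add]; ring
  have h4 : ip S S = ∑ i, (μ i - 1) ^ 2 := by
    have : ∀ i, (μ i - 1) ^ 2 = μ i ^ 2 - 2 * μ i + 1 := fun i => by ring
    simp only [this, Finset.sum_add_distrib, Finset.sum_sub_distrib, ← Finset.mul_sum, ← h2, ← h3]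
    simp; ring
  have h5 : S.trace = ∑ i, (μ i - 1) := by
    simp only [Finset.sum_sub_distrib, ← h2]; simp
  rw [h1, Real.log_prod fun i _ => (hP.eigenvalues_pos i).ne', h5, h4, ← Finset.sum_sub_distrib]
  refine Finset.sum_le_sum fun i _ => ?_
  have h6 : (μ i - 1) ^ 2 ≤ (1 / 2) ^ 2 := by
    have := Finset.single_le_sum (f := fun i => (μ i - 1) ^ 2) (fun i _ => sq_nonneg _)
      (Finset.mem_univ i)
    simp only [← h4] at this
    linarith
  have := sub_sq_le_log_one_add (abs_le_of_sq_le_sq h6 (by norm_num))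
  simpa using this

/-! ### Scaling by the square root of a positive definite matrix -/

/-- The inverse `X^{-1/2} B X^{-1/2}` of the scaling `B ↦ X^{1/2} B X^{1/2}`. -/
def unscale (X B : Mat n) : Mat n := (CFC.sqrt X)⁻¹ * B * (CFC.sqrt X)⁻¹

variable {X : Mat n}

theorem sqrt_mul_sqrt (hX : X.PosDef) : CFC.sqrt X * CFC.sqrt X = X :=
  CFC.sqrt_mul_sqrt_self X hX.posSemidef.nonneg

theorem sqrt_isHermitian (X : Mat n) : (CFC.sqrt X).IsHermitian :=
  (CFC.sqrt_nonneg X).posSemidef.1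

theorem isUnit_det_sqrt (hX : X.PosDef) : IsUnit (CFC.sqrt X).det := by
  have h : (CFC.sqrt X).det * (CFC.sqrt X).det = X.det := by rw [← det_mul, sqrt_mul_sqrt hX]
  rw [isUnit_iff_ne_zero]
  intro h0
  rw [h0, mul_zero] at h
  exact hX.det_pos.ne h

theorem isUnit_sqrt (hX : X.PosDef) : IsUnit (CFC.sqrt X) :=
  (Matrix.isUnit_iff_isUnit_det _).2 (isUnit_det_sqrt hX)

theorem inv_eq_inv_sqrt_mul (hX : X.PosDef) : X⁻¹ = (CFC.sqrt X)⁻¹ * (CFC.sqrt X)⁻¹ := by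
  rw [← Matrix.mul_inv_rev, sqrt_mul_sqrt hX]

theorem rescale_unscale (hX : X.PosDef) (B : Mat n) : rescale X (unscale X B) = B := by
  rw [rescale, unscale, Matrix.mul_assoc, Matrix.mul_assoc, Matrix.mul_assoc,
    Matrix.nonsing_inv_mul _ (isUnit_det_sqrt hX), Matrix.mul_one, ← Matrix.mul_assoc,
    Matrix.mul_nonsing_inv _ (isUnit_det_sqrt hX), Matrix.one_mul]

theorem unscale_rescale (hX : X.PosDef) (B : Mat n) : unscale X (rescale X B) = B := by
  rw [rescale, unscale, Matrix.mul_assoc, Matrix.mul_assoc, Matrix.mul_assoc,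
    Matrix.mul_nonsing_inv _ (isUnit_det_sqrt hX), Matrix.mul_one, ← Matrix.mul_assoc,
    Matrix.nonsing_inv_mul _ (isUnit_det_sqrt hX), Matrix.one_mul]

theorem rescale_isSymm (X : Mat n) {B : Mat n} (hB : B.IsSymm) : (rescale X B).IsSymm := by
  have h := isSymm_of_isHermitian (sqrt_isHermitian X)
  simp only [rescale, Matrix.IsSymm, Matrix.transpose_mul, h.eq, hB.eq, Matrix.mul_assoc]

theorem unscale_isSymm (X : Mat n) {B : Mat n} (hB : B.IsSymm) : (unscale X B).IsSymm := by
  have h := isSymm_of_isHermitian (sqrt_isHermitian X)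
  simp only [unscale, Matrix.IsSymm, Matrix.transpose_mul, Matrix.transpose_nonsing_inv, h.eq,
    hB.eq, Matrix.mul_assoc]

theorem rescale_posDef (hX : X.PosDef) {B : Mat n} : (rescale X B).PosDef ↔ B.PosDef := by
  have := Matrix.IsUnit.posDef_star_left_conjugate_iff (x := B) (isUnit_sqrt hX)
  rwa [Matrix.star_eq_conjTranspose, (sqrt_isHermitian X).eq] at this

theorem rescale_posSemidef (hX : X.PosDef) {B : Mat n} :
    (rescale X B).PosSemidef ↔ B.PosSemidef := by
  have := Matrix.IsUnit.posSemidef_star_left_conjugate_iff (x := B) (isUnit_sqrt hX)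
  rwa [Matrix.star_eq_conjTranspose, (sqrt_isHermitian X).eq] at this

theorem det_rescale (hX : X.PosDef) (B : Mat n) : (rescale X B).det = X.det * B.det := by
  conv_rhs => rw [← sqrt_mul_sqrt hX]
  simp only [rescale, det_mul]; ring

theorem ip_rescale (X A B : Mat n) : ip A (rescale X B) = ip (rescale X A) B := by
  rw [ip, ip, rescale, rescale, ← Matrix.mul_assoc, Matrix.trace_mul_comm]
  simp only [Matrix.mul_assoc]

theorem rescale_add (X A B : Mat n) : rescale X (A + B) = rescale X A + rescale X B := by
  simp [rescale, mul_add, add_mul]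

theorem rescale_smul (c : ℝ) (X B : Mat n) : rescale X (c • B) = c • rescale X B := by
  simp [rescale]

theorem rescale_one (hX : X.PosDef) : rescale X 1 = X := by
  simp [rescale, sqrt_mul_sqrt hX]

theorem unscale_sub (X A B : Mat n) : unscale X (A - B) = unscale X A - unscale X B := by
  simp [unscale, mul_sub, sub_mul]

theorem unscale_self (hX : X.PosDef) : unscale X X = 1 := by
  conv_lhs => rw [← rescale_one hX]
  rw [rescale_one hX, ← unscale_rescale hX 1, rescale_one hX]

theorem ip_inv_eq_trace_unscale (hX : X.PosDef) (B : Mat n) : ip X⁻¹ B = (unscale X B).trace := by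
  rw [ip, inv_eq_inv_sqrt_mul hX, unscale, Matrix.mul_assoc, Matrix.trace_mul_comm]

theorem trace_inv_mul_inv_mul (hX : X.PosDef) (A B : Mat n) :
    (X⁻¹ * A * X⁻¹ * B).trace = ip (unscale X A) (unscale X B) := by
  rw [ip, inv_eq_inv_sqrt_mul hX, unscale, unscale]
  simp only [Matrix.mul_assoc]
  rw [Matrix.trace_mul_comm]
  simp only [Matrix.mul_assoc]

/-- Concavity of `log det`: it lies below its tangent planes. -/
theorem log_det_le_tangent {Z : Mat n} (hZ : Z.PosDef) (hX : X.PosDef) :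
    Real.log X.det ≤ Real.log Z.det + ip Z⁻¹ (X - Z) := by
  have hU : (unscale Z X).PosDef := by rwa [← rescale_posDef hZ, rescale_unscale hZ]
  have h1 := log_det_le_trace_sub hU
  have h2 : X.det = Z.det * (unscale Z X).det := by rw [← det_rescale hZ, rescale_unscale hZ]
  rw [h2, Real.log_mul hZ.det_pos.ne' hU.det_pos.ne', ip_inv_eq_trace_unscale hZ, unscale_sub,
    unscale_self hZ, Matrix.trace_sub, Matrix.trace_one]
  simpa using h1

/-- Congruence by `X^{-1/2}` moves the centre to the identity: the Dikin ellipsoid of radius 1/2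
lies in the cone. -/
theorem posDef_add_of_small (hX : X.PosDef) {S : Mat n} (hS : S.IsSymm)
    (h : ip (unscale X S) (unscale X S) ≤ 1 / 4) : (X + S).PosDef := by
  have h1 := posDef_one_add (unscale_isSymm X hS) h
  rwa [← rescale_posDef hX, rescale_add, rescale_one hX, rescale_unscale hX] at h1

theorem log_det_add_of_small (hX : X.PosDef) {S : Mat n} (hS : S.IsSymm)
    (h : ip (unscale X S) (unscale X S) ≤ 1 / 4) :
    Real.log X.det + (ip X⁻¹ S - ip (unscale X S) (unscale X S)) ≤ Real.log (X + S).det := by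
  have hP := posDef_one_add (unscale_isSymm X hS) h
  have h1 := log_det_one_add (unscale_isSymm X hS) h
  have h2 : X + S = rescale X (1 + unscale X S) := by
    rw [rescale_add, rescale_one hX, rescale_unscale hX]
  rw [h2, det_rescale hX, Real.log_mul hX.det_pos.ne' hP.det_pos.ne', ip_inv_eq_trace_unscale hX]
  linarith

/-! ### Compact sets of positive semidefinite matrices -/

theorem isClosed_posSemidef : IsClosed {S : Mat n | S.PosSemidef} := by
  have : {S : Mat n | S.PosSemidef} =
      {S | Sᴴ = S} ∩ ⋂ x : Fin n → ℝ, {S | 0 ≤ star x ⬝ᵥ (S *ᵥ x)} := by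
    ext S
    simp [Matrix.posSemidef_iff_dotProduct_mulVec, Matrix.IsHermitian]
  rw [this]
  refine (isClosed_eq (by fun_prop) (by fun_prop)).inter (isClosed_iInter fun x => ?_)
  exact isClosed_le continuous_const (by fun_prop)

/-- Testing `S` on the sum and difference of two unit vectors bounds an entry by the mean of two
diagonal entries, each at most the trace. -/
theorem abs_apply_le_trace {S : Mat n} (hS : S.PosSemidef) (i j : Fin n) : |S i j| ≤ S.trace := by
  have hd : ∀ i, 0 ≤ S i i := fun i => hS.diag_nonneg
  have htr : ∀ i, S i i ≤ S.trace := fun i =>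
    Finset.single_le_sum (f := fun i => S i i) (fun i _ => hd i) (Finset.mem_univ i)
  have hsym : S j i = S i j := (isSymm_of_isHermitian hS.1).apply i j
  have key : ∀ c : ℝ, 0 ≤ S i i + c * S i j + (c * S j i + c * c * S j j) := fun c => by
    have := hS.dotProduct_mulVec_nonneg (Pi.single i 1 + c • Pi.single j 1)
    simp [Matrix.mulVec_add, Matrix.mulVec_smul, add_dotProduct, smul_dotProduct,
      dotProduct_add] at this
    linarith
  have h1 := key 1
  have h2 := key (-1)
  rw [abs_le]
  constructor <;> linarith [htr i, htr j]

theorem isCompact_posSemidef_trace_le (c : ℝ) :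
    IsCompact {S : Mat n | S.PosSemidef ∧ S.trace ≤ c} := by
  have hc : IsCompact (Set.univ.pi fun _ : Fin n => Set.univ.pi fun _ : Fin n => Set.Icc (-c) c) :=
    isCompact_univ_pi fun _ => isCompact_univ_pi fun _ => isCompact_Icc
  refine IsCompact.of_isClosed_subset hc
    (isClosed_posSemidef.inter (isClosed_le continuous_id.matrix_trace continuous_const)) ?_
  rintro S ⟨hS, ht⟩ i - j -
  exact abs_le.1 ((abs_apply_le_trace hS i j).trans ht)

theorem continuous_rescale (X : Mat n) : Continuous (rescale X) := by
  unfold rescale; fun_prop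

theorem isCompact_posSemidef_ip_inv_le {Z : Mat n} (hZ : Z.PosDef) (c : ℝ) :
    IsCompact {S : Mat n | S.PosSemidef ∧ ip Z⁻¹ S ≤ c} := by
  have : {S : Mat n | S.PosSemidef ∧ ip Z⁻¹ S ≤ c} =
      rescale Z '' {S : Mat n | S.PosSemidef ∧ S.trace ≤ c} := by
    ext S
    constructor
    · rintro ⟨hS, h⟩
      refine ⟨unscale Z S, ⟨?_, ?_⟩, rescale_unscale hZ S⟩
      · rwa [← rescale_posSemidef hZ, rescale_unscale hZ]
      · rwa [← ip_inv_eq_trace_unscale hZ]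
    · rintro ⟨T, ⟨hT, h⟩, rfl⟩
      refine ⟨(rescale_posSemidef hZ).2 hT, ?_⟩
      rwa [ip_inv_eq_trace_unscale hZ, unscale_rescale hZ]
  rw [this]
  exact (isCompact_posSemidef_trace_le c).image (continuous_rescale Z)

end MatrixFacts

/-! ### First and second directional derivatives of the two barriers. -/

section Derivatives

open Filter Topology

variable {n : ℕ}

theorem hasDerivAt_det_one_add (M : Mat n) :
    HasDerivAt (fun t : ℝ => (1 + t • M).det) M.trace 0 := by
  have h : (fun t : ℝ => (1 + t • M).det) = fun t => 1 + M.trace * t +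
      ((1 + (Polynomial.X : Polynomial ℝ) • M.map Polynomial.C).det.divX.divX).eval t * t ^ 2 := by
    ext t; exact Matrix.det_one_add_smul t M
  rw [h]
  have h1 := (((hasDerivAt_id (0 : ℝ)).const_mul M.trace).const_add 1).add
    ((Polynomial.hasDerivAt
      ((1 + (Polynomial.X : Polynomial ℝ) • M.map Polynomial.C).det.divX.divX) 0).mul
      (hasDerivAt_pow 2 (0 : ℝ)))
  refine h1.congr_deriv ?_
  simp

theorem hasDerivAt_fSDP {X : Mat n} (hX : X.det ≠ 0) (W : Mat n) :
    HasDerivAt (fun t : ℝ => fSDP (X + t • W)) (-ip X⁻¹ W) 0 := by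
  have hU : IsUnit X.det := isUnit_iff_ne_zero.2 hX
  have h : (fun t : ℝ => fSDP (X + t • W)) =
      fun t => -Real.log (X.det * (1 + t • (X⁻¹ * W)).det) := by
    ext t
    rw [fSDP, ← det_mul, mul_add, mul_one, Matrix.mul_smul, Matrix.mul_nonsing_inv_cancel_left _ _ hU]
  rw [h]
  have h1 := (hasDerivAt_det_one_add (X⁻¹ * W)).const_mul X.det
  have h2 := (h1.log (by simpa using hX)).neg
  refine h2.congr_deriv ?_
  simp only [zero_smul, add_zero, det_one, mul_one, ip]
  field_simp

theorem lineDeriv_fSDP {X : Mat n} (hX : X.det ≠ 0) (W : Mat n) :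
    lineDeriv ℝ fSDP X W = -ip X⁻¹ W := (hasDerivAt_fSDP hX W).deriv

theorem continuous_line (X U : Mat n) : Continuous fun t : ℝ => X + t • U := by fun_prop

theorem eventually_det_ne_zero {X : Mat n} (hX : X.det ≠ 0) (U : Mat n) :
    ∀ᶠ t : ℝ in 𝓝 0, (X + t • U).det ≠ 0 := by
  have hc : ContinuousAt (fun t : ℝ => (X + t • U).det) 0 :=
    (continuous_line X U).matrix_det.continuousAt
  exact hc.eventually_ne (by simpa using hX)

/-- Cramer's rule gives continuity of the inverse along a line, which is all that iterated
directional derivatives require. -/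
theorem continuousAt_inv_line {X : Mat n} (hX : X.det ≠ 0) (U : Mat n) :
    ContinuousAt (fun t : ℝ => (X + t • U)⁻¹) 0 := by
  have h : (fun t : ℝ => (X + t • U)⁻¹) =
      fun t => ((X + t • U).det)⁻¹ • (X + t • U).adjugate := by
    ext1 t
    rw [Matrix.inv_def, Ring.inverse_eq_inv']
  rw [h]
  have h1 : ContinuousAt (fun t : ℝ => ((X + t • U).det)⁻¹) 0 :=
    (continuous_line X U).matrix_det.continuousAt.inv₀ (by simpa using hX)
  exact h1.smul (continuous_line X U).matrix_adjugate.continuousAt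

theorem hasDerivAt_ip_inv {X : Mat n} (hX : X.det ≠ 0) (U W : Mat n) :
    HasDerivAt (fun t : ℝ => -ip (X + t • U)⁻¹ W) ((X⁻¹ * U * X⁻¹ * W).trace) 0 := by
  rw [hasDerivAt_iff_tendsto_slope]
  have hc : Tendsto (fun t : ℝ => (X⁻¹ * U * (X + t • U)⁻¹ * W).trace) (𝓝[≠] 0)
      (𝓝 (X⁻¹ * U * X⁻¹ * W).trace) := by
    have h1 := continuousAt_inv_line hX U
    have h2 : ContinuousAt (fun t : ℝ => (X⁻¹ * U * (X + t • U)⁻¹ * W).trace) 0 := by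
      have h3 : Continuous fun M : Mat n => (X⁻¹ * U * M * W).trace :=
        Continuous.matrix_trace (by fun_prop)
      exact h3.continuousAt.comp h1
    have h4 := h2.tendsto
    simp only [zero_smul, add_zero] at h4
    exact h4.mono_left nhdsWithin_le_nhds
  refine hc.congr' ?_
  filter_upwards [nhdsWithin_le_nhds (eventually_det_ne_zero hX U), self_mem_nhdsWithin]
    with t ht ht0
  have ht0' : t ≠ 0 := ht0
  -- Resolvent identity: it writes the difference quotient as an expression continuous in `t`, so
  -- the derivative is its value at 0.
  have key : X⁻¹ - (X + t • U)⁻¹ = t • (X⁻¹ * U * (X + t • U)⁻¹) := by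
    calc X⁻¹ - (X + t • U)⁻¹ = X⁻¹ * ((X + t • U) - X) * (X + t • U)⁻¹ := by
          rw [Matrix.mul_sub, Matrix.sub_mul, Matrix.mul_assoc,
            Matrix.mul_nonsing_inv _ (isUnit_iff_ne_zero.2 ht),
            Matrix.nonsing_inv_mul _ (isUnit_iff_ne_zero.2 hX)]
          simp
      _ = _ := by simp
  have h5 : (X⁻¹ * U * (X + t • U)⁻¹ * W).trace = t⁻¹ * (ip X⁻¹ W - ip (X + t • U)⁻¹ W) := by
    rw [ip, ip, ← Matrix.trace_sub, ← Matrix.sub_mul, key]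
    simp [ht0']
  rw [h5, slope_def_field]
  simp only [zero_smul, add_zero, sub_zero]
  field_simp
  ring

theorem hess_fSDP {X : Mat n} (hX : X.det ≠ 0) (U W : Mat n) :
    hess fSDP X U W = (X⁻¹ * U * X⁻¹ * W).trace := by
  refine HasDerivAt.deriv ?_
  refine (hasDerivAt_ip_inv hX U W).congr_of_eventuallyEq ?_
  filter_upwards [eventually_det_ne_zero hX U] with t ht
  exact lineDeriv_fSDP ht W

variable {k : ℕ}

theorem fFW_eq_sum (Y : Blocks n k) : fFW Y = ∑ J, fSDP (Y J) := by
  simp [fFW, fSDP]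

theorem lineDeriv_fFW {Y : Blocks n k} (hY : ∀ J, (Y J).det ≠ 0) (W : Blocks n k) :
    lineDeriv ℝ fFW Y W = -∑ J, ip (Y J)⁻¹ (W J) := by
  have h := HasDerivAt.fun_sum (u := Finset.univ) fun J _ => hasDerivAt_fSDP (hY J) (W J)
  rw [← Finset.sum_neg_distrib]
  refine HasDerivAt.deriv (h.congr_of_eventuallyEq (Eventually.of_forall fun t => ?_))
  simp [fFW_eq_sum]

theorem hess_fFW {Y : Blocks n k} (hY : ∀ J, (Y J).det ≠ 0) (U W : Blocks n k) :
    hess fFW Y U W = ∑ J, ((Y J)⁻¹ * U J * (Y J)⁻¹ * W J).trace := by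
  have h := HasDerivAt.fun_sum (u := Finset.univ) fun J _ => hasDerivAt_ip_inv (hY J) (U J) (W J)
  refine HasDerivAt.deriv (h.congr_of_eventuallyEq ?_)
  filter_upwards [eventually_all.2 fun J => eventually_det_ne_zero (hY J) (U J)] with t ht
  rw [lineDeriv_fFW (Y := Y + t • U) (fun J => ht J)]
  simp

end Derivatives

/-! ### Existence of Newton steps and the equations that define them. -/

section NewtonSteps

/-- A linear functional on a subspace is represented by a form that is definite there. -/
theorem exists_represents {E : Type*} [AddCommGroup E] [Module ℝ E] [FiniteDimensional ℝ E]
    (B : E →ₗ[ℝ] E →ₗ[ℝ] ℝ) (l : E →ₗ[ℝ] ℝ) (V : Submodule ℝ E)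
    (hB : ∀ v ∈ V, B v v = 0 → v = 0) : ∃ s ∈ V, ∀ d ∈ V, B s d = l d := by
  let T : V →ₗ[ℝ] Module.Dual ℝ V := (B.domRestrict₁₂ V V)
  have hT : Function.Injective T := by
    rw [← LinearMap.ker_eq_bot, LinearMap.ker_eq_bot']
    intro v hv
    have h1 : B v v = 0 := LinearMap.congr_fun hv v
    exact Subtype.ext (hB v v.2 h1)
  have hT' : Function.Surjective T :=
    (LinearMap.injective_iff_surjective_of_finrank_eq_finrank
      (Subspace.dual_finrank_eq (K := ℝ) (V := V)).symm).1 hT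
  obtain ⟨s, hs⟩ := hT' (l.domRestrict V)
  exact ⟨s, s.2, fun d hd => LinearMap.congr_fun hs ⟨d, hd⟩⟩

theorem newtonStep_spec {E : Type*} [AddCommGroup E] [Module ℝ E] {f : E → ℝ}
    {L : AffineSubspace ℝ E} {x : E} (h : ∃ s, IsNewtonStep f L x s) :
    IsNewtonStep f L x (newtonStep f L x) := by
  rw [newtonStep, dif_pos h]
  exact h.choose_spec

variable {n k : ℕ}

theorem unscale_add (X A B : Mat n) : unscale X (A + B) = unscale X A + unscale X B := by
  simp [unscale, mul_add, add_mul]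

theorem unscale_smul (c : ℝ) (X B : Mat n) : unscale X (c • B) = c • unscale X B := by
  simp [unscale]

theorem unscale_eq_zero {X : Mat n} (hX : X.PosDef) {B : Mat n} (h : unscale X B = 0) : B = 0 := by
  rw [← rescale_unscale hX B, h]; simp [rescale]

/-- The local inner product of `fFW` at `Y`. -/
def blockIp (Y U W : Blocks n k) : ℝ := ∑ J, ip (unscale (Y J) (U J)) (unscale (Y J) (W J))

theorem hess_fSDP_eq {X : Mat n} (hX : X.PosDef) (U W : Mat n) :
    hess fSDP X U W = ip (unscale X U) (unscale X W) := by
  rw [hess_fSDP hX.det_pos.ne', trace_inv_mul_inv_mul hX]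

theorem hess_fFW_eq {Y : Blocks n k} (hY : BlocksPosDef Y) (U W : Blocks n k) :
    hess fFW Y U W = blockIp Y U W := by
  rw [hess_fFW fun J => (hY J).det_pos.ne', blockIp]
  exact Finset.sum_congr rfl fun J _ => trace_inv_mul_inv_mul (hY J) _ _

/-- Symmetry of the directions is needed for existence: the Hessian form `tr (X⁻¹ U X⁻¹ U)` is a sum
of squares, hence definite, on symmetric `U`. -/
theorem newtonStep_fSDP {X : Mat n} (hX : X.PosDef) (L : AffineSubspace ℝ (Mat n))
    (hL : ∀ d ∈ L.direction, d.IsSymm) :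
    newtonStep fSDP L X ∈ L.direction ∧ ∀ d ∈ L.direction,
      ip (unscale X (newtonStep fSDP L X)) (unscale X d) = ip X⁻¹ d := by
  have hex : ∃ s, IsNewtonStep fSDP L X s := by
    obtain ⟨s, hs, h⟩ := exists_represents
      (LinearMap.mk₂ ℝ (fun U W => ip (unscale X U) (unscale X W))
        (fun a b c => by simp [unscale_add, ip, add_mul])
        (fun a b c => by simp [unscale_smul, ip])
        (fun a b c => by simp [unscale_add, ip, mul_add])
        (fun a b c => by simp [unscale_smul, ip]))
      ((Matrix.traceLinearMap (Fin n) ℝ ℝ).comp (LinearMap.mulLeft ℝ X⁻¹)) L.direction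
      (fun v hv h0 => unscale_eq_zero hX
        (eq_zero_of_ip_self_eq_zero (unscale_isSymm X (hL v hv)) h0))
    refine ⟨s, hs, fun d hd => ?_⟩
    rw [hess_fSDP_eq hX, lineDeriv_fSDP hX.det_pos.ne', neg_neg]
    exact h d hd
  obtain ⟨h1, h2⟩ := newtonStep_spec hex
  refine ⟨h1, fun d hd => ?_⟩
  have := h2 d hd
  rwa [hess_fSDP_eq hX, lineDeriv_fSDP hX.det_pos.ne', neg_neg] at this

theorem newtonStep_fFW {Y : Blocks n k} (hY : BlocksPosDef Y)
    (L : AffineSubspace ℝ (Blocks n k)) (hL : ∀ d ∈ L.direction, ∀ J, (d J).IsSymm) :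
    newtonStep fFW L Y ∈ L.direction ∧ ∀ d ∈ L.direction,
      blockIp Y (newtonStep fFW L Y) d = ∑ J, ip (Y J)⁻¹ (d J) := by
  have hdet := fun J => (hY J).det_pos.ne'
  have hex : ∃ s, IsNewtonStep fFW L Y s := by
    obtain ⟨s, hs, h⟩ := exists_represents
      (LinearMap.mk₂ ℝ (blockIp Y)
        (fun a b c => by simp [blockIp, unscale_add, ip, add_mul, Finset.sum_add_distrib])
        (fun a b c => by simp [blockIp, unscale_smul, ip, Finset.mul_sum])
        (fun a b c => by simp [blockIp, unscale_add, ip, mul_add, Finset.sum_add_distrib])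
        (fun a b c => by simp [blockIp, unscale_smul, ip, Finset.mul_sum]))
      (∑ J, (Matrix.traceLinearMap (Fin k) ℝ ℝ).comp
        ((LinearMap.mulLeft ℝ (Y J)⁻¹).comp (LinearMap.proj J))) L.direction
      (fun v hv h0 => by
        funext J
        change blockIp Y v v = 0 at h0
        have h1 := (Finset.sum_eq_zero_iff_of_nonneg
          (fun J _ => ip_self_nonneg (unscale_isSymm (Y J) (hL v hv J)))).1 h0 J
          (Finset.mem_univ J)
        exact unscale_eq_zero (hY J)
          (eq_zero_of_ip_self_eq_zero (unscale_isSymm (Y J) (hL v hv J)) h1))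
    refine ⟨s, hs, fun d hd => ?_⟩
    rw [hess_fFW_eq hY, lineDeriv_fFW hdet, neg_neg]
    refine (h d hd).trans ?_
    simp [ip]
  obtain ⟨h1, h2⟩ := newtonStep_spec hex
  refine ⟨h1, fun d hd => ?_⟩
  have := h2 d hd
  rwa [hess_fFW_eq hY, lineDeriv_fFW hdet, neg_neg] at this

end NewtonSteps

/-! ### The maps between block collections and matrices. -/

section BlockMaps

variable {n k : ℕ}

/-- The order embedding of `Fin k` onto `J`. -/
abbrev emb (J : Idx n k) : Fin k ↪o Fin n := J.1.orderEmbOfFin J.2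

/-- The `k × n` matrix that selects the coordinates in `J`. -/
def sel (J : Idx n k) : Matrix (Fin k) (Fin n) ℝ := fun p i => if i = emb J p then 1 else 0

theorem embed_eq (J : Idx n k) (S : Mat k) : embed J S = (sel J)ᴴ * S * sel J := by
  ext i j
  simp only [embed, sel, Matrix.mul_apply, Matrix.conjTranspose_apply, Finset.sum_mul]
  rw [Finset.sum_comm]
  refine Finset.sum_congr rfl fun q _ => Finset.sum_congr rfl fun p _ => ?_
  by_cases h1 : i = emb J p <;> by_cases h2 : j = emb J q <;> simp [h1, h2]

theorem sel_mul_mul (J : Idx n k) (M : Mat n) :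
    sel J * M * (sel J)ᴴ = M.submatrix (emb J) (emb J) := by
  ext p q
  simp [sel, Matrix.mul_apply]

/-- The adjoint of `embed J` is the restriction to the principal submatrix. -/
theorem ip_embed (J : Idx n k) (M : Mat n) (S : Mat k) :
    ip M (embed J S) = ip (M.submatrix (emb J) (emb J)) S := by
  rw [ip, ip, embed_eq, ← sel_mul_mul, ← Matrix.mul_assoc, Matrix.trace_mul_comm]
  simp only [Matrix.mul_assoc]

theorem ip_sum {ι : Type*} (s : Finset ι) (M : Mat n) (f : ι → Mat n) :
    ip M (∑ i ∈ s, f i) = ∑ i ∈ s, ip M (f i) := by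
  simp [ip, Matrix.mul_sum, Matrix.trace_sum]

theorem ip_Psi (M : Mat n) (Y : Blocks n k) :
    ip M (Psi Y) = ∑ J, ip (M.submatrix (emb J) (emb J)) (Y J) := by
  rw [Psi, ip_sum]
  exact Finset.sum_congr rfl fun J _ => ip_embed J M (Y J)

theorem Psi_add (Y W : Blocks n k) : Psi (Y + W) = Psi Y + Psi W := by
  simp [Psi, embed_eq, Matrix.mul_add, Matrix.add_mul, Finset.sum_add_distrib]

theorem Psi_smul (c : ℝ) (Y : Blocks n k) : Psi (c • Y) = c • Psi Y := by
  simp [Psi, embed_eq, Finset.smul_sum]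

theorem Psi_posSemidef {Y : Blocks n k} (hY : BlocksPosSemidef Y) : (Psi Y).PosSemidef :=
  Matrix.posSemidef_sum _ fun J _ => by
    rw [embed_eq]; exact (hY J).conjTranspose_mul_mul_same _

/-- The number of `k`-sets containing a given set. -/
theorem card_filter_subset (T : Finset (Fin n)) (h : T.card ≤ k) :
    (Finset.univ.filter fun J : Idx n k => T ⊆ J.1).card =
      (n - T.card).choose (k - T.card) := by
  have h1 := Finset.card_filter_powersetCard_subset T Finset.univ k (Finset.subset_univ _) h
  rw [Finset.card_univ, Fintype.card_fin] at h1
  rw [← h1]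
  refine Finset.card_bij (fun J _ => J.1) ?_ ?_ ?_
  · intro J hJ
    simpa [J.2] using hJ
  · intro J _ J' _ h
    exact Subtype.ext h
  · intro S hS
    simp only [Finset.mem_filter, Finset.mem_powersetCard] at hS
    exact ⟨⟨S, hS.1.2⟩, by simpa using hS.2, rfl⟩

theorem emb_mem (J : Idx n k) (p : Fin k) : emb J p ∈ J.1 := Finset.orderEmbOfFin_mem _ _ _

theorem exists_emb_eq {J : Idx n k} {i : Fin n} (hi : i ∈ J.1) : ∃ p, emb J p = i := by
  have := Finset.range_orderEmbOfFin J.1 J.2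
  rw [Set.ext_iff] at this
  exact (this i).2 hi

theorem embed_apply_emb (J : Idx n k) (S : Mat k) (p q : Fin k) :
    embed J S (emb J p) (emb J q) = S p q := by
  simp [embed, ite_and]

theorem embed_apply_of_notMem_left {J : Idx n k} (S : Mat k) {i : Fin n} (hi : i ∉ J.1)
    (j : Fin n) : embed J S i j = 0 := by
  refine Finset.sum_eq_zero fun p _ => Finset.sum_eq_zero fun q _ => if_neg ?_
  rintro ⟨rfl, -⟩
  exact hi (emb_mem J p)

theorem embed_apply_of_notMem_right {J : Idx n k} (S : Mat k) {j : Fin n} (hj : j ∉ J.1)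
    (i : Fin n) : embed J S i j = 0 := by
  refine Finset.sum_eq_zero fun p _ => Finset.sum_eq_zero fun q _ => if_neg ?_
  rintro ⟨-, rfl⟩
  exact hj (emb_mem J q)

theorem embed_apply_eq_ite (J : Idx n k) (w : Fin n → Fin n → ℝ) (i j : Fin n) :
    embed J (fun p q => w (emb J p) (emb J q)) i j = if {i, j} ⊆ J.1 then w i j else 0 := by
  split_ifs with h
  · obtain ⟨p, rfl⟩ := exists_emb_eq (h (by simp) : i ∈ J.1)
    obtain ⟨q, rfl⟩ := exists_emb_eq (h (by simp) : j ∈ J.1)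
    exact embed_apply_emb J _ p q
  · by_cases hi : i ∈ J.1
    · refine embed_apply_of_notMem_right _ (fun hj => h ?_) i
      intro x hx
      rcases Finset.mem_insert.1 hx with rfl | hx
      · exact hi
      · rwa [Finset.mem_singleton.1 hx]
    · exact embed_apply_of_notMem_left _ hi j

/-- The entry at `(i, j)` is collected from the `k`-sets containing `{i, j}`; the weights in
`PsiDagger` are the reciprocals of their numbers in the diagonal and off-diagonal cases. -/
theorem Psi_PsiDagger (hk : 2 ≤ k) (hkn : k ≤ n) (X : Mat n) :
    Psi (PsiDagger X : Blocks n k) = X := by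
  ext i j
  set w : Fin n → Fin n → ℝ := fun i j =>
    (if i = j then 1 / ((n - 1).choose (k - 1) : ℝ) else 1 / ((n - 2).choose (k - 2) : ℝ)) * X i j
    with hw
  have h1 : ∀ J : Idx n k, (PsiDagger X : Blocks n k) J = fun p q => w (emb J p) (emb J q) := by
    intro J
    ext p q
    simp only [PsiDagger, hw, EmbeddingLike.apply_eq_iff_eq]
  have h2 : Psi (PsiDagger X : Blocks n k) i j =
      ((Finset.univ.filter fun J : Idx n k => {i, j} ⊆ J.1).card : ℝ) * w i j := by
    simp only [Psi, h1, Matrix.sum_apply]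
    rw [Finset.sum_congr rfl fun J _ => embed_apply_eq_ite J w i j, Finset.sum_ite]
    simp
  have hc : ({i, j} : Finset (Fin n)).card ≤ 2 := Finset.card_le_two
  rw [h2, card_filter_subset _ (hc.trans hk), hw]
  by_cases hij : i = j
  · subst hij
    have : ((n - 1).choose (k - 1) : ℝ) ≠ 0 := by
      exact_mod_cast (Nat.choose_pos (by omega)).ne'
    simp [this]
  · have : ((n - 2).choose (k - 2) : ℝ) ≠ 0 := by
      exact_mod_cast (Nat.choose_pos (by omega)).ne'
    simp [hij, Finset.card_pair hij, this]

theorem PsiDagger_one : PsiDagger (1 : Mat n) = Y0 n k := by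
  ext J p q
  by_cases h : p = q <;> simp [PsiDagger, Y0, Matrix.one_apply, h]

theorem Psi_Y0 (hk : 2 ≤ k) (hkn : k ≤ n) : Psi (Y0 n k) = 1 := by
  rw [← PsiDagger_one, Psi_PsiDagger hk hkn]

theorem PsiDagger_isSymm {X : Mat n} (hX : X.IsSymm) (J : Idx n k) :
    ((PsiDagger X : Blocks n k) J).IsSymm := by
  refine Matrix.IsSymm.ext fun p q => ?_
  simp only [PsiDagger, hX.apply, eq_comm]

theorem choose_pos_cast (hkn : k ≤ n) : (0 : ℝ) < ((n - 1).choose (k - 1) : ℝ) := by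
  exact_mod_cast Nat.choose_pos (by omega)

theorem Y0_posDef (hkn : k ≤ n) : BlocksPosDef (Y0 n k) := fun _ =>
  Matrix.PosDef.one.smul (one_div_pos.2 (choose_pos_cast hkn))

/-- A nonzero vector has a nonzero coordinate, and some `k`-set contains it; that block contributes
strictly, the others nonnegatively. -/
theorem Psi_posDef (hk : 2 ≤ k) (hkn : k ≤ n) {Y : Blocks n k} (hY : BlocksPosDef Y) :
    (Psi Y).PosDef := by
  have hS := Psi_posSemidef fun J => (hY J).posSemidef
  refine Matrix.PosDef.of_dotProduct_mulVec_pos hS.1 fun x hx => ?_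
  have hval : ∀ J, star x ⬝ᵥ (embed J (Y J) *ᵥ x) =
      star (sel J *ᵥ x) ⬝ᵥ (Y J *ᵥ (sel J *ᵥ x)) := by
    intro J
    rw [embed_eq, Matrix.star_mulVec, ← Matrix.dotProduct_mulVec, Matrix.mulVec_mulVec,
      Matrix.mulVec_mulVec, Matrix.mul_assoc]
  rw [Psi, Matrix.sum_mulVec, dotProduct_sum]
  obtain ⟨i, hi⟩ := Function.ne_iff.1 hx
  obtain ⟨S, hiS, -, hS⟩ := Finset.exists_subsuperset_card_eq (n := k)
    (Finset.subset_univ {i}) (by simp; omega) (by simpa using hkn)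
  refine Finset.sum_pos' (fun J _ => ?_) ⟨⟨S, hS⟩, Finset.mem_univ _, ?_⟩
  · rw [hval]; exact (hY J).posSemidef.dotProduct_mulVec_nonneg _
  · rw [hval]
    refine (hY _).dotProduct_mulVec_pos fun h0 => hi ?_
    obtain ⟨p, hp⟩ := exists_emb_eq (J := ⟨S, hS⟩) (hiS (Finset.mem_singleton_self i))
    have := congrFun h0 p
    simpa [sel, Matrix.mulVec, dotProduct, hp] using this

end BlockMaps

/-! ### Partitions into `k`-sets and the comparison of the two barriers -/

section Partitions

variable {n k r : ℕ}

/-- Ordered families of pairwise disjoint `k`-sets. -/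
def IsPart (P : Fin r → Idx n k) : Prop := ∀ a b, a ≠ b → Disjoint (P a).1 (P b).1

theorem exists_isPart (hn : n = k * r) : ∃ P : Fin r → Idx n k, IsPart P := by
  subst hn
  let e : Fin k × Fin r ≃ Fin (k * r) := finProdFinEquiv
  refine ⟨fun a => ⟨Finset.univ.map ⟨fun p => e (p, a), fun p q h => by simpa using h⟩, by simp⟩,
    fun a b hab => ?_⟩
  rw [Finset.disjoint_left]
  intro x hx hx'
  simp only [Finset.mem_map, Finset.mem_univ, true_and] at hx hx'
  obtain ⟨p, rfl⟩ := hx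
  obtain ⟨q, hq⟩ := hx'
  have := e.injective hq
  simp only [Prod.mk.injEq] at this
  exact hab this.2.symm

theorem exists_perm_map_eq (J J' : Idx n k) :
    ∃ g : Equiv.Perm (Fin n), J.1.map g.toEmbedding = J'.1 := by
  have e : {x // x ∈ J.1} ≃ {x // x ∈ J'.1} :=
    Fintype.equivOfCardEq (by simp [J.2, J'.2])
  refine ⟨e.extendSubtype, Finset.eq_of_subset_of_card_le ?_ (by simp [J.2, J'.2])⟩
  intro x hx
  obtain ⟨y, hy, rfl⟩ := Finset.mem_map.1 hx
  exact e.extendSubtype_mem y hy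

open Classical in
/-- The number of occurrences of `J` in ordered partitions. -/
def occ (r : ℕ) (J : Idx n k) : ℕ :=
  (Finset.univ.filter fun x : (Fin r → Idx n k) × Fin r => IsPart x.1 ∧ x.1 x.2 = J).card

/-- A permutation carrying `J` to `J'` maps partitions through `J` injectively to partitions through
`J'`. Exchanging the roles gives equality. -/
theorem occ_le (J J' : Idx n k) : occ r J ≤ occ r J' := by
  classical
  obtain ⟨g, hg⟩ := exists_perm_map_eq J J'
  let G : Idx n k → Idx n k := fun I => ⟨I.1.map g.toEmbedding, by simp [I.2]⟩
  have hG : Function.Injective G := fun I I' h =>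
    Subtype.ext (Finset.map_injective g.toEmbedding (congrArg Subtype.val h))
  refine Finset.card_le_card_of_injOn (fun x => (fun a => G (x.1 a), x.2)) ?_ ?_
  · rintro ⟨P, a⟩ hx
    simp only [Finset.coe_filter, Finset.mem_univ, true_and, Set.mem_ofPred_eq] at hx ⊢
    obtain ⟨hP, rfl⟩ := hx
    refine ⟨fun b c hbc => ?_, Subtype.ext hg⟩
    exact (Finset.disjoint_map g.toEmbedding).2 (hP b c hbc)
  · rintro ⟨P, a⟩ _ ⟨Q, b⟩ _ h
    simp only [Prod.mk.injEq] at h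
    refine Prod.ext (funext fun c => hG (congrFun h.1 c)) h.2

open Classical in
/-- Summing over all blocks of all ordered partitions is summing over all `k`-sets, with a
constant multiplicity. -/
theorem sum_isPart {M : Type*} [AddCommGroup M] [Module ℝ M] (J₀ : Idx n k) (F : Idx n k → M) :
    ∑ P ∈ Finset.univ.filter (IsPart (n := n) (k := k) (r := r)), ∑ a, F (P a) =
      (occ r J₀ : ℝ) • ∑ J, F J := by
  have hocc : ∀ J : Idx n k, occ r J = occ r J₀ := fun J => le_antisymm (occ_le _ _) (occ_le _ _)
  have h1 : ∑ P ∈ Finset.univ.filter (IsPart (n := n) (k := k) (r := r)), ∑ a, F (P a) =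
      ∑ x ∈ Finset.univ.filter (fun x : (Fin r → Idx n k) × Fin r => IsPart x.1), F (x.1 x.2) := by
    rw [Finset.sum_filter, Finset.sum_filter, Fintype.sum_prod_type]
    refine Finset.sum_congr rfl fun P _ => ?_
    split_ifs <;> simp
  rw [h1, ← Finset.sum_fiberwise _ (fun x : (Fin r → Idx n k) × Fin r => x.1 x.2), Finset.smul_sum]
  refine Finset.sum_congr rfl fun J _ => ?_
  rw [Finset.filter_filter, Finset.sum_congr rfl (g := fun _ => F J)
    (fun x hx => by rw [(Finset.mem_filter.1 hx).2.2]), Finset.sum_const, ← hocc J, occ,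
    Nat.cast_smul_eq_nsmul]

theorem choose_eq_mul (hn : n = k * r) (hk : 0 < k) (hr : 0 < r) :
    n.choose k = r * (n - 1).choose (k - 1) := by
  obtain ⟨k', rfl⟩ : ∃ k', k = k' + 1 := ⟨k - 1, by omega⟩
  obtain ⟨n', rfl⟩ : ∃ n', n = n' + 1 := ⟨n - 1, by
    have : 0 < n := hn ▸ Nat.mul_pos hk hr
    omega⟩
  have h := Nat.add_one_mul_choose_eq n' k'
  simp only [Nat.add_sub_cancel]
  nth_rewrite 1 [hn] at h
  have : (k' + 1) * (r * n'.choose k') = (k' + 1) * (n' + 1).choose (k' + 1) := by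
    rw [← mul_assoc, h]; ring
  exact (Nat.eq_of_mul_eq_mul_left (Nat.succ_pos _) this).symm

-- Double counting of pairs (partition, position): each partition has `r` positions, and there are
-- `r * C` sets `J`, each occurring equally often.
open Classical in
theorem card_isPart_eq (hn : n = k * r) (hk : 0 < k) (hr : 0 < r) (J₀ : Idx n k) :
    ((Finset.univ.filter (IsPart (n := n) (k := k) (r := r))).card : ℝ) =
      occ r J₀ * ((n - 1).choose (k - 1) : ℝ) := by
  have h := sum_isPart (r := r) J₀ (fun _ => (1 : ℝ))
  simp only [Finset.sum_const, Finset.card_univ, Fintype.card_fin, nsmul_eq_mul, mul_one,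
    smul_eq_mul] at h
  have hI : Fintype.card (Idx n k) = n.choose k := by
    simp
  rw [hI, choose_eq_mul hn hk hr] at h
  push_cast at h
  have hr' : (r : ℝ) ≠ 0 := by exact_mod_cast hr.ne'
  apply mul_right_cancel₀ hr'
  rw [h]; ring

/-- The block-diagonal matrix obtained from the blocks of a partition. -/
def partSum (P : Fin r → Idx n k) (Y : Blocks n k) : Mat n := ∑ a, embed (P a) (Y (P a))

/-- Disjointness and the cardinality `n = k * r` make the blocks cover all indices, so a reindexing
turns the matrix into a block-diagonal one. -/
theorem det_partSum (hn : n = k * r) {P : Fin r → Idx n k} (hP : IsPart P) (Y : Blocks n k) :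
    (partSum P Y).det = ∏ a, (Y (P a)).det := by
  let f : Fin k × Fin r → Fin n := fun x => emb (P x.2) x.1
  have hf : Function.Injective f := by
    rintro ⟨p, a⟩ ⟨q, b⟩ h
    by_cases hab : a = b
    · subst hab
      simpa [f] using h
    · refine (Finset.disjoint_left.1 (hP a b hab) (emb_mem (P a) p) ?_).elim
      have h' : emb (P a) p = emb (P b) q := h
      rw [h']; exact emb_mem _ _
  have hb : Function.Bijective f :=
    (Fintype.bijective_iff_injective_and_card f).2 ⟨hf, by simp [hn]⟩
  let e := Equiv.ofBijective f hb
  rw [← det_submatrix_equiv_self e, ← det_blockDiagonal]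
  congr 1
  ext ⟨p, a⟩ ⟨q, b⟩
  have hnot : ∀ {a c : Fin r} (p : Fin k), c ≠ a → emb (P a) p ∉ (P c).1 := fun p hc h =>
    Finset.disjoint_left.1 (hP _ _ hc) h (emb_mem _ p)
  change partSum P Y (emb (P a) p) (emb (P b) q) = _
  rw [partSum, Matrix.sum_apply, Finset.sum_eq_single a
    (fun c _ hc => embed_apply_of_notMem_left _ (hnot p hc) _) (by simp)]
  by_cases hab : a = b
  · subst hab
    rw [embed_apply_emb, blockDiagonal_apply_eq]
  · rw [blockDiagonal_apply_ne _ _ _ hab, embed_apply_of_notMem_right _ (hnot q hab)]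

theorem partSum_posDef (hn : n = k * r) {P : Fin r → Idx n k} (hP : IsPart P) {Y : Blocks n k}
    (hY : BlocksPosDef Y) : (partSum P Y).PosDef := by
  have h : (partSum P Y).PosSemidef := Matrix.posSemidef_sum _ fun a _ => by
    rw [embed_eq]; exact (hY _).posSemidef.conjTranspose_mul_mul_same _
  rw [h.posDef_iff_det_ne_zero, det_partSum hn hP]
  exact Finset.prod_ne_zero_iff.2 fun a _ => (hY _).det_pos.ne'

/-- Comparison of the barriers along `Ψ`. -/
theorem fSDP_Psi_le (hk : 2 ≤ k) (hr : 0 < r) (hn : n = k * r) {Y : Blocks n k}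
    (hY : BlocksPosDef Y) :
    ((n - 1).choose (k - 1) : ℝ) * fSDP (Psi Y) ≤ fFW Y - fFW (Y0 n k) := by
  classical
  have hkn : k ≤ n := hn ▸ Nat.le_mul_of_pos_right k hr
  have hC := choose_pos_cast hkn
  set C : ℝ := ((n - 1).choose (k - 1) : ℝ) with hCdef
  have hX := Psi_posDef hk hkn hY
  set Z : Mat n := C⁻¹ • Psi Y with hZdef
  have hZ : Z.PosDef := hX.smul (inv_pos.2 hC)
  obtain ⟨P₀, hP₀⟩ := exists_isPart hn
  set J₀ := P₀ ⟨0, hr⟩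
  set Q := Finset.univ.filter (IsPart (n := n) (k := k) (r := r)) with hQ
  have hcard : (Q.card : ℝ) = occ r J₀ * C := card_isPart_eq hn (by omega) hr J₀
  have hpos : (0 : ℝ) < Q.card := by
    exact_mod_cast Finset.card_pos.2 ⟨P₀, by simpa [hQ] using hP₀⟩
  have hocc : (0 : ℝ) < occ r J₀ := by
    rw [hcard] at hpos; exact pos_of_mul_pos_left hpos hC.le
  -- Jensen's inequality in tangent form, with the tangent taken at `Z`, the mean of the `partSum P
  -- Y`; the linear terms therefore cancel in `hright`.
  have hsum : ∑ P ∈ Q, Real.log (partSum P Y).det ≤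
      ∑ P ∈ Q, (Real.log Z.det + ip Z⁻¹ (partSum P Y - Z)) :=
    Finset.sum_le_sum fun P hP =>
      log_det_le_tangent hZ (partSum_posDef hn (Finset.mem_filter.1 hP).2 hY)
  have hleft : ∑ P ∈ Q, Real.log (partSum P Y).det = occ r J₀ * (-fFW Y) := by
    rw [fFW, neg_neg, ← smul_eq_mul, ← sum_isPart J₀ fun J => Real.log (Y J).det]
    refine Finset.sum_congr rfl fun P hP => ?_
    rw [det_partSum hn (Finset.mem_filter.1 hP).2, Real.log_prod fun a _ => (hY _).det_pos.ne']
  have hright : ∑ P ∈ Q, (Real.log Z.det + ip Z⁻¹ (partSum P Y - Z)) =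
      occ r J₀ * C * Real.log Z.det := by
    rw [Finset.sum_add_distrib, ← ip_sum, Finset.sum_sub_distrib, Finset.sum_const, Finset.sum_const]
    have h1 : ∑ P ∈ Q, partSum P Y = (occ r J₀ : ℝ) • Psi Y :=
      sum_isPart J₀ fun J => embed J (Y J)
    rw [h1, ← Nat.cast_smul_eq_nsmul ℝ, ← Nat.cast_smul_eq_nsmul ℝ, hcard, hZdef, smul_smul,
      mul_assoc, mul_inv_cancel₀ hC.ne', mul_one, sub_self, ip_zero, add_zero, smul_eq_mul]
  rw [hleft, hright, mul_assoc] at hsum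
  have h2 : -fFW Y ≤ C * Real.log Z.det := le_of_mul_le_mul_left hsum hocc
  have h3 : Real.log Z.det = -(n * Real.log C) + Real.log (Psi Y).det := by
    rw [hZdef, det_smul, Real.log_mul (by positivity) hX.det_pos.ne', Real.log_pow,
      Real.log_inv, Fintype.card_fin]
    ring
  -- There are `r * C` blocks, each contributing `k * log C`; with `k * r = n` this cancels exactly
  -- the scaling term from `h3`.
  have h4 : fFW (Y0 n k) = C * (n * Real.log C) := by
    have hI : Fintype.card (Idx n k) = n.choose k := by
      simp
    simp only [fFW, Y0, det_smul, Fintype.card_fin, det_one, mul_one, Real.log_pow, one_div,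
      Real.log_inv, Finset.sum_const, Finset.card_univ, hI, nsmul_eq_mul,
      choose_eq_mul hn (by omega) hr]
    have hn' : (n : ℝ) = k * r := by exact_mod_cast hn
    push_cast
    rw [← hCdef, hn']
    ring
  rw [fSDP, h4]
  rw [h3] at h2
  linarith

end Partitions

/-! ### Membership in the slices and in their direction spaces. -/

section Slices

variable {n k m : ℕ} {A₀ : Mat n} {A : Fin m → Mat n} {b : Fin m → ℝ} {v : ℝ}

theorem mem_slice {X : Mat n} :
    X ∈ slice A₀ A b v ↔ X.IsSymm ∧ ip A₀ X = v ∧ ∀ i, ip (A i) X = b i := Iff.rfl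

theorem mem_slice_direction {X : Mat n} (hX : X ∈ slice A₀ A b v) {d : Mat n} :
    d ∈ (slice A₀ A b v).direction ↔ d.IsSymm ∧ ip A₀ d = 0 ∧ ∀ i, ip (A i) d = 0 := by
  rw [← AffineSubspace.vadd_mem_iff_mem_direction d hX, vadd_eq_add, mem_slice, ip_add, hX.2.1]
  simp only [ip_add, hX.2.2, add_eq_right]
  refine and_congr_left fun _ => ⟨fun h => ?_, fun h => h.add hX.1⟩
  have := h.sub hX.1
  rwa [add_sub_cancel_right] at this

theorem mem_sliceAt {X S : Mat n} : S ∈ sliceAt A₀ A b v X ↔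
    S.IsSymm ∧ ip A₀ (rescale X S) = v ∧ ∀ i, ip (A i) (rescale X S) = b i := by
  simp only [ip_rescale]; exact Iff.rfl

theorem mem_blockSliceAt {X : Mat n} {Y : Blocks n k} : Y ∈ blockSliceAt k A₀ A b v X ↔
    (∀ J, (Y J).IsSymm) ∧ ip A₀ (rescale X (Psi Y)) = v ∧
      ∀ i, ip (A i) (rescale X (Psi Y)) = b i := by
  simp only [ip_rescale]; exact Iff.rfl

theorem mem_blockSliceAt_direction {X : Mat n} {Y : Blocks n k}
    (hY : Y ∈ blockSliceAt k A₀ A b v X) {d : Blocks n k} :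
    d ∈ (blockSliceAt k A₀ A b v X).direction ↔ (∀ J, (d J).IsSymm) ∧
      ip A₀ (rescale X (Psi d)) = 0 ∧ ∀ i, ip (A i) (rescale X (Psi d)) = 0 := by
  rw [← AffineSubspace.vadd_mem_iff_mem_direction d hY, vadd_eq_add, mem_blockSliceAt]
  rw [mem_blockSliceAt] at hY
  simp only [Psi_add, rescale_add, ip_add, hY.2.1, hY.2.2, add_eq_right]
  refine and_congr_left fun _ => forall_congr' fun J => ⟨fun h => ?_, fun h => h.add (hY.1 J)⟩
  have := h.sub (hY.1 J)
  rwa [Pi.add_apply, add_sub_cancel_right] at this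

theorem Y0_mem_blockSliceAt (hk : 2 ≤ k) (hkn : k ≤ n) {X : Mat n} (hX : StrictlyFeasible A b X)
    (hv : ip A₀ X = v) : Y0 n k ∈ blockSliceAt k A₀ A b v X := by
  rw [mem_blockSliceAt, Psi_Y0 hk hkn, rescale_one hX.1]
  exact ⟨fun J => isSymm_of_isHermitian (Y0_posDef hkn J).1, hv, hX.2⟩

theorem StrictlyFeasible.mem_slice {X : Mat n} (hX : StrictlyFeasible A b X) (hv : ip A₀ X = v) :
    X ∈ slice A₀ A b v := ⟨isSymm_of_isHermitian hX.1.1, hv, hX.2⟩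

theorem StrictlyFeasible.one_mem_sliceAt {X : Mat n} (hX : StrictlyFeasible A b X)
    (hv : ip A₀ X = v) : 1 ∈ sliceAt A₀ A b v X := by
  rw [mem_sliceAt, rescale_one hX.1]
  exact ⟨Matrix.isSymm_one, hv, hX.2⟩

end Slices

/-! ### Central points: optimality, existence at lower values, and closeness. -/

section CentralPath

open Filter Topology

variable {n m : ℕ} {A₀ : Mat n} {A : Fin m → Mat n} {b : Fin m → ℝ}

theorem eventually_posDef {X : Mat n} (hX : X.PosDef) {d : Mat n} (hd : d.IsSymm) :
    ∀ᶠ t : ℝ in 𝓝 0, (X + t • d).PosDef := by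
  have hc : Tendsto (fun t : ℝ => t ^ 2 * ip (unscale X d) (unscale X d)) (𝓝 0) (𝓝 0) := by
    have : Continuous fun t : ℝ => t ^ 2 * ip (unscale X d) (unscale X d) := by fun_prop
    simpa using this.tendsto 0
  filter_upwards [hc.eventually (eventually_le_nhds (show (0 : ℝ) < 1 / 4 by norm_num))] with t ht
  refine posDef_add_of_small hX (hd.smul t) (le_of_eq_of_le ?_ ht)
  rw [unscale_smul, ip_smul, ip_comm, ip_smul]; ring

/-- First-order condition for a minimizer of `c ⟨A₀, X⟩ - log det X` along a direction. -/
theorem ip_inv_eq_of_isMin {z d : Mat n} (hz : z.PosDef) (hd : d.IsSymm) (c : ℝ)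
    (hmin : ∀ t : ℝ, (z + t • d).PosDef →
      c * ip A₀ z + fSDP z ≤ c * ip A₀ (z + t • d) + fSDP (z + t • d)) :
    ip z⁻¹ d = c * ip A₀ d := by
  have h1 : HasDerivAt (fun t : ℝ => c * ip A₀ (z + t • d) + fSDP (z + t • d))
      (c * ip A₀ d + -ip z⁻¹ d) 0 := by
    refine HasDerivAt.add ?_ (hasDerivAt_fSDP hz.det_pos.ne' d)
    simp only [ip_add, ip_smul]
    simpa using (((hasDerivAt_id (0 : ℝ)).mul_const (ip A₀ d)).const_add (ip A₀ z)).const_mul c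
  have h2 : IsLocalMin (fun t : ℝ => c * ip A₀ (z + t • d) + fSDP (z + t • d)) 0 := by
    filter_upwards [eventually_posDef hz hd] with t ht
    simpa using hmin t ht
  have := h2.hasDerivAt_eq_zero h1
  linarith

theorem IsCentralPoint.ip_inv_eq {η : ℝ} {z : Mat n} (h : IsCentralPoint A₀ A b η z) {d : Mat n}
    (hd : d.IsSymm) (hd' : ∀ i, ip (A i) d = 0) : ip z⁻¹ d = η * ip A₀ d :=
  ip_inv_eq_of_isMin h.2.1.1 hd η fun t ht => h.2.2 _ ⟨ht, fun i => by
    rw [ip_add, ip_smul, hd', mul_zero, add_zero, h.2.1.2 i]⟩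

theorem ip_inv_self {z : Mat n} (hz : z.PosDef) : ip z⁻¹ z = n := by
  rw [ip_inv_eq_trace_unscale hz, unscale_self hz]; simp

theorem ip_inv_nonneg {z S : Mat n} (hz : z.PosDef) (hS : S.PosSemidef) : 0 ≤ ip z⁻¹ S := by
  rw [ip_inv_eq_trace_unscale hz]
  refine Matrix.PosSemidef.trace_nonneg ?_
  rwa [← rescale_posSemidef hz, rescale_unscale hz]

/-- On the affine space of the constraints, `⟨z⁻¹, ·⟩` only depends on the objective value. -/
theorem IsCentralPoint.ip_inv_eq_add {η : ℝ} {z : Mat n} (h : IsCentralPoint A₀ A b η z)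
    {X : Mat n} (hX : X.IsSymm) (hX' : ∀ i, ip (A i) X = b i) :
    ip z⁻¹ X = n + η * (ip A₀ X - ip A₀ z) := by
  have h1 := h.ip_inv_eq (d := X - z) (hX.sub (isSymm_of_isHermitian h.2.1.1.1))
    (fun i => by rw [ip_sub, hX', h.2.1.2 i, sub_self])
  rw [ip_sub, ip_sub, ip_inv_self h.2.1.1] at h1
  linarith

/-- Since `η > 0`, optimality compares `z` with points of every smaller value, not just of its own
slice. The old central point can thus bound the corrector's potential. -/
theorem IsCentralPoint.fSDP_le {η : ℝ} {z : Mat n} (h : IsCentralPoint A₀ A b η z) {X : Mat n}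
    (hX : StrictlyFeasible A b X) (hv : ip A₀ X ≤ ip A₀ z) : fSDP z ≤ fSDP X := by
  have := h.2.2 X hX
  nlinarith [h.1]

theorem continuous_ip (M : Mat n) : Continuous (ip M) := by
  unfold ip; exact Continuous.matrix_trace (by fun_prop)

/-- The central path reaches every smaller objective value of a strictly feasible point. -/
theorem exists_isCentralPoint {η₁ : ℝ} {z₁ X : Mat n} (h : IsCentralPoint A₀ A b η₁ z₁)
    (hX : StrictlyFeasible A b X) (hv : ip A₀ X ≤ ip A₀ z₁) :
    ∃ η z, IsCentralPoint A₀ A b η z ∧ ip A₀ z = ip A₀ X := by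
  rcases hv.eq_or_lt with hv | hv
  · exact ⟨η₁, z₁, h, hv.symm⟩
  set v := ip A₀ X with hvdef
  have hz₁ := h.2.1.1
  -- The inequality holds with equality on the slice by `ip_inv_eq_add`; stating it makes the closed
  -- slice compact.
  let T : Set (Mat n) := {S | S.PosSemidef ∧ ip z₁⁻¹ S ≤ n + η₁ * (v - ip A₀ z₁)} ∩
    ({S | ip A₀ S = v} ∩ ⋂ i, {S | ip (A i) S = b i})
  have hT : IsCompact T := (isCompact_posSemidef_ip_inv_le hz₁ _).inter_right
    ((isClosed_eq (continuous_ip _) continuous_const).inter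
      (isClosed_iInter fun i => isClosed_eq (continuous_ip _) continuous_const))
  have hmemT : ∀ S : Mat n, S.PosDef → ip A₀ S = v → (∀ i, ip (A i) S = b i) → S ∈ T := by
    intro S hS h0 hA
    refine ⟨⟨hS.posSemidef, ?_⟩, h0, Set.mem_iInter.2 hA⟩
    rw [h.ip_inv_eq_add (isSymm_of_isHermitian hS.1) hA, h0]
  -- Maximizing `det` rather than `log det` allows singular points; the maximum is at least `X.det >
  -- 0`, so the maximizer is nonsingular.
  obtain ⟨z, hzT, hzmax⟩ := hT.exists_isMaxOn ⟨X, hmemT X hX.1 rfl hX.2⟩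
    (continuous_id.matrix_det.continuousOn (s := T))
  have hzdet : 0 < z.det := hX.1.det_pos.trans_le (hzmax (hmemT X hX.1 rfl hX.2))
  have hz : z.PosDef := hzT.1.1.posDef_iff_det_ne_zero.2 hzdet.ne'
  have hz0 : ip A₀ z = v := hzT.2.1
  have hzA : ∀ i, ip (A i) z = b i := fun i => Set.mem_iInter.1 hzT.2.2 i
  have hcrit : ∀ d : Mat n, d.IsSymm → ip A₀ d = 0 → (∀ i, ip (A i) d = 0) → ip z⁻¹ d = 0 := by
    intro d hd hd0 hdA
    have := ip_inv_eq_of_isMin (A₀ := A₀) hz hd 0 fun t ht => by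
      have hmem : z + t • d ∈ T := hmemT _ ht (by rw [ip_add, ip_smul, hd0, hz0]; ring)
        (fun i => by rw [ip_add, ip_smul, hdA, hzA]; ring)
      have hle : (z + t • d).det ≤ z.det := hzmax hmem
      have := Real.log_le_log ht.det_pos hle
      simp only [fSDP]
      linarith
    simpa using this
  have hzs := isSymm_of_isHermitian hz.1
  have hz₁s := isSymm_of_isHermitian hz₁.1
  have hgap : 0 < ip A₀ z₁ - v := sub_pos.2 hv
  -- By `hcrit`, `⟨z⁻¹, ·⟩` is a multiple of `⟨A₀, ·⟩` on constraint directions; the factor is read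
  -- off along `z₁ - z`.
  set η := ip z⁻¹ (z₁ - z) / (ip A₀ z₁ - v) with hη
  have hgrad : ∀ d : Mat n, d.IsSymm → (∀ i, ip (A i) d = 0) → ip z⁻¹ d = η * ip A₀ d := by
    intro d hd hdA
    have h1 := hcrit (d - (ip A₀ d / (ip A₀ z₁ - v)) • (z₁ - z))
      (hd.sub ((hz₁s.sub hzs).smul _))
      (by rw [ip_sub, ip_smul, ip_sub A₀, hz0]; field_simp; ring)
      (fun i => by rw [ip_sub, ip_smul, ip_sub (A i), hzA, h.2.1.2 i, hdA]; ring)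
    rw [ip_sub, ip_smul] at h1
    rw [hη]
    have h2 : ip z⁻¹ d = ip A₀ d / (ip A₀ z₁ - v) * ip z⁻¹ (z₁ - z) := by linarith
    rw [h2]; ring
  have hηpos : 0 < η := by
    refine div_pos ?_ hgap
    -- Optimality of `z₁` makes its log-determinant exceed that of `z`, and the tangent at `z`
    -- bounds this excess by the numerator of `η`.
    have h1 := log_det_le_tangent hz hz₁
    have h2 := h.2.2 z ⟨hz, hzA⟩
    rw [fSDP, fSDP, hz0] at h2
    nlinarith [mul_pos h.1 hgap]
  refine ⟨η, z, ⟨hηpos, ⟨hz, hzA⟩, fun S hS => ?_⟩, hz0⟩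
  have h1 := log_det_le_tangent hz hS.1
  rw [hgrad (S - z) ((isSymm_of_isHermitian hS.1.1).sub hzs)
    (fun i => by rw [ip_sub, hS.2, hzA, sub_self]), ip_sub] at h1
  rw [fSDP, fSDP]
  linarith

/-- A small Newton decrement bounds the distance of the barrier to its minimum on the slice. -/
theorem fSDP_sub_le {X z : Mat n} (hX : StrictlyFeasible A b X) (hz : StrictlyFeasible A b z)
    (hv : ip A₀ z = ip A₀ X) (hclose : newtonDecrement fSDP (slice A₀ A b (ip A₀ X)) X ≤ 1 / 9) :
    fSDP X - fSDP z ≤ 1 / 81 := by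
  have hmem := hX.mem_slice (A₀ := A₀) rfl
  obtain ⟨hN, hNd⟩ := newtonStep_fSDP hX.1 (slice A₀ A b (ip A₀ X))
    (fun d hd => ((mem_slice_direction hmem).1 hd).1)
  rw [newtonDecrement] at hclose
  set N := newtonStep fSDP (slice A₀ A b (ip A₀ X)) X
  rw [hess_fSDP_eq hX.1] at hclose
  set S := unscale X N
  have hNs := ((mem_slice_direction hmem).1 hN).1
  have hS : S.IsSymm := unscale_isSymm X hNs
  have hSS : ip S S ≤ 1 / 81 := by
    have h0 := ip_self_nonneg hS
    have := (Real.sqrt_le_left (by norm_num)).1 hclose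
    norm_num at this ⊢
    linarith
  have htrS : S.trace = ip S S := by rw [hNd N hN, ip_inv_eq_trace_unscale hX.1]
  set z' := unscale X z
  have hz' : z'.PosDef := by rw [← rescale_posDef hX.1, rescale_unscale hX.1]; exact hz.1
  have htr : ip S (z' - 1) = (z' - 1).trace := by
    have hd : z - X ∈ (slice A₀ A b (ip A₀ X)).direction :=
      AffineSubspace.vsub_mem_direction (hz.mem_slice hv) hmem
    have h1 := hNd _ hd
    rw [ip_inv_eq_trace_unscale hX.1, unscale_sub, unscale_self hX.1] at h1
    exact h1
  have hneg : ip (-S) (-S) = ip S S := by simp [ip]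
  have hM : (1 + -S).PosDef := posDef_one_add hS.neg (by rw [hneg]; linarith)
  have hMlog := log_det_one_add hS.neg (by rw [hneg]; linarith)
  -- Tangent at `(1 - S)⁻¹`: by the Newton equation `htr` the slope term is the constant `-S.trace`,
  -- so `log det z'` is at most `ip S S`.
  have htan := log_det_le_tangent hM.inv hz'
  have hMu : IsUnit (1 + -S).det := isUnit_iff_ne_zero.2 hM.det_pos.ne'
  rw [Matrix.nonsing_inv_nonsing_inv _ hMu, Matrix.det_nonsing_inv, Ring.inverse_eq_inv',
    Real.log_inv] at htan
  have hexp : ip (1 + -S) (z' - (1 + -S)⁻¹) = -S.trace := by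
    rw [ip_sub, ip, ip, Matrix.mul_nonsing_inv _ hMu]
    rw [ip_sub, ip, ip, Matrix.mul_one] at htr
    simp only [Matrix.add_mul, Matrix.one_mul, Matrix.neg_mul, Matrix.trace_add, Matrix.trace_neg,
      Matrix.trace_sub] at htr ⊢
    linarith
  rw [hexp] at htan
  rw [hneg, Matrix.trace_neg] at hMlog
  have hdet : z.det = X.det * z'.det := by rw [← det_rescale hX.1, rescale_unscale hX.1]
  rw [fSDP, fSDP, hdet, Real.log_mul hX.1.det_pos.ne' hz'.det_pos.ne']
  linarith

end CentralPath

/-! ### The predictor step: feasibility, objective decrease, barrier increase. -/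

section Predictor

variable {n k m : ℕ} {A₀ : Mat n} {A : Fin m → Mat n} {b : Fin m → ℝ}

/-- Monotonicity of `log det`, obtained from the tangent plane at the larger matrix. -/
theorem log_det_smul_one_add {c : ℝ} (hc : 0 < c) {S : Mat n} (hS : S.PosSemidef) :
    n * Real.log c ≤ Real.log (c • (1 : Mat n) + S).det := by
  have h1 : (c • (1 : Mat n)).PosDef := Matrix.PosDef.one.smul hc
  have hP : (c • (1 : Mat n) + S).PosDef := h1.add_posSemidef hS
  have h2 := log_det_le_tangent hP h1
  rw [sub_add_cancel_left, ← neg_one_smul ℝ S, ip_smul, det_smul, det_one, mul_one,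
    Fintype.card_fin, Real.log_pow] at h2
  linarith [ip_inv_nonneg hP hS]

theorem isClosed_blocksPosSemidef_line (Y Z : Blocks n k) :
    IsClosed {s : ℝ | BlocksPosSemidef (Y + s • Z)} := by
  have : {s : ℝ | BlocksPosSemidef (Y + s • Z)} =
      ⋂ J, (fun s : ℝ => Y J + s • Z J) ⁻¹' {S | S.PosSemidef} := by
    ext s; simp [BlocksPosSemidef]
  rw [this]
  exact isClosed_iInter fun J => isClosed_posSemidef.preimage (continuous_line _ _)

theorem predictor_spec (hk : 2 ≤ k) (hkn : k ≤ n) (hA₀ : A₀.IsSymm) (hA : ∀ i, (A i).IsSymm)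
    {σ : ℝ} (hσ0 : 0 < σ) (hσ1 : σ < 1) {X X' : Mat n} (hX : StrictlyFeasible A b X)
    {η : ℝ} {z : Mat n} (hz : IsCentralPoint A₀ A b η z) (hzv : ip A₀ z = ip A₀ X)
    (hpred : IsPredictorStep k A₀ A σ X X') :
    StrictlyFeasible A b X' ∧ ip A₀ X' ≤ ip A₀ X ∧
      fSDP X' ≤ fSDP X + n * Real.log (1 / (1 - σ)) := by
  obtain ⟨y, hy, hX'⟩ := hpred
  set W : Mat n := ∑ j, y j • rescale X (A j) - rescale X A₀ with hW
  set Z : Blocks n k := PsiDagger W with hZ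
  set T : Set ℝ := {s : ℝ | BlocksPosSemidef (Y0 n k + s • Z)} with hT
  have hPsi : ∀ s : ℝ, Psi (Y0 n k + s • Z) = 1 + s • W := fun s => by
    rw [Psi_add, Psi_smul, Psi_Y0 hk hkn, hZ, Psi_PsiDagger hk hkn]
  have hWs : W.IsSymm := by
    refine Matrix.IsSymm.sub ?_ (rescale_isSymm X hA₀)
    rw [Matrix.IsSymm, Matrix.transpose_sum]
    exact Finset.sum_congr rfl fun j _ => ((rescale_isSymm X (hA j)).smul (y j)).eq
  have hWA : ∀ i, ip (rescale X (A i)) W = 0 := fun i => by rw [hW, ip_sub, hy i, sub_self]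
  -- `W` is minus the projection of the rescaled `A₀`, and it is orthogonal to the span of the
  -- rescaled constraints.
  have hWW : ip (rescale X A₀) W = -ip W W := by
    have h1 : ip W W = ip W (∑ j, y j • rescale X (A j)) - ip W (rescale X A₀) := by
      conv_lhs => rw [hW, ← hW, hW]
      rw [← ip_sub]
    have h2 : ip W (∑ j, y j • rescale X (A j)) = 0 := by
      rw [ip_sum]
      refine Finset.sum_eq_zero fun j _ => ?_
      rw [ip_smul, ip_comm, hWA, mul_zero]
    rw [ip_comm _ W]
    linarith
  have hobj : ∀ s : ℝ, ip A₀ (rescale X (1 + s • W)) = ip A₀ X - s * ip W W := fun s => by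
    rw [rescale_add, rescale_one hX.1, rescale_smul, ip_add, ip_smul, ip_rescale, hWW]; ring
  have hcon : ∀ (s : ℝ) i, ip (A i) (rescale X (1 + s • W)) = b i := fun s i => by
    rw [rescale_add, rescale_one hX.1, rescale_smul, ip_add, ip_smul, ip_rescale, hWA, hX.2 i]; ring
  have hT0 : (0 : ℝ) ∈ T := fun J => by simpa using (Y0_posDef hkn J).posSemidef
  have hstar : sSup T ∈ T ∧ 0 ≤ sSup T := by
    by_cases hW0 : W = 0
    -- Here the supremum is over all of `ℝ`, where `sSup` takes the default value 0.
    · have hTu : T = Set.univ := by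
        refine Set.eq_univ_of_forall fun s J => ?_
        have hZ0 : Z J = 0 := by ext p q; simp [hZ, hW0, PsiDagger]
        simpa [hZ0] using (Y0_posDef hkn J).posSemidef
      rw [hTu, Real.sSup_univ]
      exact ⟨trivial, le_rfl⟩
    · have hq : 0 < ip W W := lt_of_le_of_ne (ip_self_nonneg hWs)
        fun h => hW0 (eq_zero_of_ip_self_eq_zero hWs h.symm)
      have hbdd : BddAbove T := by
        -- `⟨z⁻¹, ·⟩` is nonnegative on the cone and equals `n - η s ⟨W, W⟩` along the step.
        refine ⟨n / (η * ip W W), fun s hs => ?_⟩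
        have hpsd : (rescale X (1 + s • W)).PosSemidef := by
          rw [rescale_posSemidef hX.1, ← hPsi]; exact Psi_posSemidef hs
        have h1 := ip_inv_nonneg hz.2.1.1 hpsd
        rw [hz.ip_inv_eq_add (isSymm_of_isHermitian hpsd.1) (hcon s), hobj, hzv] at h1
        rw [le_div_iff₀ (mul_pos hz.1 hq)]
        linarith
      exact ⟨(isClosed_blocksPosSemidef_line _ _).csSup_mem ⟨0, hT0⟩ hbdd, le_csSup hbdd hT0⟩
  set s := sSup T
  change X' = rescale X (Psi (Y0 n k + (σ * s) • Z)) at hX'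
  rw [hPsi] at hX'
  -- The new point is a convex combination of the identity and the image of the boundary collection.
  have hsplit : 1 + (σ * s) • W = (1 - σ) • (1 : Mat n) + σ • Psi (Y0 n k + s • Z) := by
    rw [hPsi, smul_add, sub_smul, one_smul, smul_smul]; abel
  have hps : (σ • Psi (Y0 n k + s • Z)).PosSemidef := (Psi_posSemidef hstar.1).smul hσ0.le
  have hPD : (1 + (σ * s) • W).PosDef := by
    rw [hsplit]
    exact (Matrix.PosDef.one.smul (sub_pos.2 hσ1)).add_posSemidef hps
  subst hX'
  refine ⟨⟨(rescale_posDef hX.1).2 hPD, hcon _⟩, ?_, ?_⟩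
  · rw [hobj]
    have := mul_nonneg (mul_nonneg hσ0.le hstar.2) (ip_self_nonneg hWs)
    linarith
  · rw [fSDP, fSDP, det_rescale hX.1, Real.log_mul hX.1.det_pos.ne' hPD.det_pos.ne', one_div,
      Real.log_inv]
    have := log_det_smul_one_add (sub_pos.2 hσ1) hps
    rw [← hsplit] at this
    linarith

end Predictor

/-! ### The corrector phase: decrease, existence of searches, decrements, potential. -/

section Corrector

variable {n k m : ℕ} {A₀ : Mat n} {A : Fin m → Mat n} {b : Fin m → ℝ} {v : ℝ} {X : Mat n}

theorem blockIp_self_nonneg {Y d : Blocks n k} (hd : ∀ J, (d J).IsSymm) : 0 ≤ blockIp Y d d :=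
  Finset.sum_nonneg fun J _ => ip_self_nonneg (unscale_isSymm _ (hd J))

/-- Summary of the Newton step of `fFW` on a slice. -/
theorem newtonStep_blockSliceAt {Y : Blocks n k} (hY : BlocksPosDef Y)
    (hYL : Y ∈ blockSliceAt k A₀ A b v X) :
    newtonStep fFW (blockSliceAt k A₀ A b v X) Y ∈ (blockSliceAt k A₀ A b v X).direction ∧
    (∀ J, (newtonStep fFW (blockSliceAt k A₀ A b v X) Y J).IsSymm) ∧
    (∀ d ∈ (blockSliceAt k A₀ A b v X).direction,
      blockIp Y (newtonStep fFW (blockSliceAt k A₀ A b v X) Y) d = ∑ J, ip (Y J)⁻¹ (d J)) ∧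
    newtonDecrement fFW (blockSliceAt k A₀ A b v X) Y ^ 2 =
      blockIp Y (newtonStep fFW (blockSliceAt k A₀ A b v X) Y)
        (newtonStep fFW (blockSliceAt k A₀ A b v X) Y) := by
  obtain ⟨h1, h2⟩ := newtonStep_fFW hY (blockSliceAt k A₀ A b v X)
    (fun d hd => ((mem_blockSliceAt_direction hYL).1 hd).1)
  have h3 := ((mem_blockSliceAt_direction hYL).1 h1).1
  refine ⟨h1, h3, h2, ?_⟩
  rw [newtonDecrement, hess_fFW_eq hY, Real.sq_sqrt (blockIp_self_nonneg h3)]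

/-- A damped Newton step decreases the barrier by a fixed amount. -/
theorem exists_decrease {Y : Blocks n k} (hY : BlocksPosDef Y)
    (hYL : Y ∈ blockSliceAt k A₀ A b v X)
    (hΔ : 1 / 14 < newtonDecrement fFW (blockSliceAt k A₀ A b v X) Y) :
    ∃ t : ℝ, BlocksPosDef (Y + t • newtonStep fFW (blockSliceAt k A₀ A b v X) Y) ∧
      fFW (Y + t • newtonStep fFW (blockSliceAt k A₀ A b v X) Y) ≤ fFW Y - 1 / 800 := by
  obtain ⟨hN, hNs, hNd, hsq⟩ := newtonStep_blockSliceAt hY hYL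
  set N := newtonStep fFW (blockSliceAt k A₀ A b v X) Y
  set Δ := newtonDecrement fFW (blockSliceAt k A₀ A b v X) Y
  -- This damping keeps `t * Δ ≤ 1/2`, so every block stays in its Dikin ellipsoid.
  set t : ℝ := 1 / (2 + 2 * Δ) with ht
  have hlin := hNd N hN
  have htpos : 0 < t := by positivity
  have htΔ : t * Δ ≤ 1 / 2 := by
    rw [ht, div_mul_eq_mul_div, div_le_iff₀ (by linarith)]; linarith
  have hq : ∀ J, ip (unscale (Y J) (t • N J)) (unscale (Y J) (t • N J)) =
      t ^ 2 * ip (unscale (Y J) (N J)) (unscale (Y J) (N J)) := fun J => by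
    rw [unscale_smul, ip_smul, ip_comm, ip_smul]; ring
  have hsmall : ∀ J, ip (unscale (Y J) (t • N J)) (unscale (Y J) (t • N J)) ≤ 1 / 4 := by
    intro J
    have h1 : ip (unscale (Y J) (N J)) (unscale (Y J) (N J)) ≤ Δ ^ 2 := by
      rw [hsq]
      exact Finset.single_le_sum
        (f := fun J => ip (unscale (Y J) (N J)) (unscale (Y J) (N J)))
        (fun J _ => ip_self_nonneg (unscale_isSymm _ (hNs J))) (Finset.mem_univ J)
    rw [hq]
    have h2 : t ^ 2 * Δ ^ 2 ≤ 1 / 4 := by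
      have : 0 ≤ t * Δ := by positivity
      nlinarith
    exact (mul_le_mul_of_nonneg_left h1 (sq_nonneg t)).trans h2
  refine ⟨t, fun J => posDef_add_of_small (hY J) ((hNs J).smul t) (hsmall J), ?_⟩
  have hsum : ∑ J, (Real.log (Y J).det + (ip (Y J)⁻¹ (t • N J) -
      ip (unscale (Y J) (t • N J)) (unscale (Y J) (t • N J)))) ≤
      ∑ J, Real.log (Y J + t • N J).det :=
    Finset.sum_le_sum fun J _ => log_det_add_of_small (hY J) ((hNs J).smul t) (hsmall J)
  simp only [hq, ip_smul, Finset.sum_add_distrib, Finset.sum_sub_distrib, ← Finset.mul_sum,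
    ← hlin] at hsum
  change _ + (t * _ - t ^ 2 * blockIp Y N N) ≤ _ at hsum
  rw [← hsq] at hsum
  -- At `Δ = 1/14` the gain is 2/1575, slightly more than 1/800.
  have hgain : 1 / 800 ≤ t * Δ ^ 2 - t ^ 2 * Δ ^ 2 := by
    have : t * Δ ^ 2 - t ^ 2 * Δ ^ 2 = Δ ^ 2 * (1 + 2 * Δ) / (2 + 2 * Δ) ^ 2 := by
      rw [ht]; field_simp; ring
    rw [this, div_le_div_iff₀ (by norm_num) (by positivity)]
    have h1 : (1 / 14) ^ 2 ≤ Δ ^ 2 := by gcongr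
    nlinarith [mul_nonneg (sq_nonneg Δ) (by linarith : 0 ≤ Δ - 1 / 14)]
  have e1 : fFW Y = -∑ J, Real.log (Y J).det := rfl
  have e2 : fFW (Y + t • N) = -∑ J, Real.log (Y J + t • N J).det := rfl
  rw [e1, e2]
  linarith

theorem trace_Psi (Y : Blocks n k) : (Psi Y).trace = ∑ J, (Y J).trace := by
  rw [← ip_one_left, ip_Psi]
  refine Finset.sum_congr rfl fun J _ => ?_
  rw [Matrix.submatrix_one _ (emb J).injective, ip_one_left]

/-- Positive semidefinite collections in a slice of the block space are bounded. -/
theorem exists_entry_bound {η : ℝ} {z : Mat n} (hz : IsCentralPoint A₀ A b η z) (hX : X.PosDef) :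
    ∃ c : ℝ, ∀ Y ∈ blockSliceAt k A₀ A b v X, BlocksPosSemidef Y → ∀ J p q, |Y J p q| ≤ c := by
  obtain ⟨c, hc⟩ := (isCompact_posSemidef_ip_inv_le hz.2.1.1
    (n + η * (v - ip A₀ z))).bddAbove_image (continuous_ip X⁻¹).continuousOn
  refine ⟨c, fun Y hYL hY J p q => (abs_apply_le_trace (hY J) p q).trans ?_⟩
  have h1 : (Y J).trace ≤ (Psi Y).trace := by
    rw [trace_Psi]
    exact Finset.single_le_sum (f := fun J => (Y J).trace) (fun J _ => (hY J).trace_nonneg)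
      (Finset.mem_univ J)
  refine h1.trans ?_
  rw [mem_blockSliceAt] at hYL
  have h2 : (Psi Y).trace = ip X⁻¹ (rescale X (Psi Y)) := by
    rw [ip_inv_eq_trace_unscale hX, unscale_rescale hX]
  rw [h2]
  have hps : (rescale X (Psi Y)).PosSemidef := (rescale_posSemidef hX).2 (Psi_posSemidef hY)
  refine hc ⟨_, ⟨hps, ?_⟩, rfl⟩
  rw [hz.ip_inv_eq_add (isSymm_of_isHermitian hps.1) hYL.2.2, hYL.2.1]

/-- A positive decrement forces a nonzero step, and the entry bound then confines the semidefinite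
part of the line to a compact set. The product of determinants is continuous up to the boundary,
where it vanishes, so its maximizer has positive definite blocks. -/
theorem exists_isLineSearch {η : ℝ} {z : Mat n} (hz : IsCentralPoint A₀ A b η z) (hX : X.PosDef)
    {Y : Blocks n k} (hY : BlocksPosDef Y) (hYL : Y ∈ blockSliceAt k A₀ A b v X)
    (hΔ : 1 / 14 < newtonDecrement fFW (blockSliceAt k A₀ A b v X) Y) :
    ∃ Y', IsLineSearch (blockSliceAt k A₀ A b v X) Y Y' := by
  obtain ⟨hN, hNs, -, hsq⟩ := newtonStep_blockSliceAt hY hYL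
  unfold IsLineSearch
  set N := newtonStep fFW (blockSliceAt k A₀ A b v X) Y
  have hN0 : N ≠ 0 := by
    intro h0
    rw [h0] at hsq
    have : blockIp Y (0 : Blocks n k) 0 = 0 := by simp [blockIp, unscale, ip]
    rw [this] at hsq
    have := pow_eq_zero_iff (two_ne_zero) |>.1 hsq
    linarith
  obtain ⟨J, hJ⟩ := Function.ne_iff.1 hN0
  obtain ⟨p, hp⟩ := Function.ne_iff.1 hJ
  obtain ⟨q, hq⟩ := Function.ne_iff.1 hp
  have hq' : 0 < |N J p q| := abs_pos.2 hq
  obtain ⟨c, hc⟩ := exists_entry_bound (k := k) (v := v) hz hX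
  set T : Set ℝ := {t | BlocksPosSemidef (Y + t • N)}
  have hTL : ∀ t : ℝ, Y + t • N ∈ blockSliceAt k A₀ A b v X := fun t => by
    rw [add_comm]
    exact AffineSubspace.vadd_mem_of_mem_direction (Submodule.smul_mem _ t hN) hYL
  have hTc : IsCompact T := by
    refine IsCompact.of_isClosed_subset
      (isCompact_Icc (a := -((c + |Y J p q|) / |N J p q|)) (b := (c + |Y J p q|) / |N J p q|))
      (isClosed_blocksPosSemidef_line Y N) fun t ht => ?_
    have h1 : |Y J p q + t * N J p q| ≤ c := hc _ (hTL t) ht J p q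
    refine abs_le.1 ?_
    rw [le_div_iff₀ hq', ← abs_mul]
    have := abs_sub (Y J p q + t * N J p q) (Y J p q)
    rw [add_sub_cancel_left] at this
    linarith
  have hcont : Continuous fun t : ℝ => ∏ J, (Y J + t • N J).det :=
    continuous_finsetProd _ fun J _ => (continuous_line _ _).matrix_det
  have hT0 : (0 : ℝ) ∈ T := fun J => by simpa using (hY J).posSemidef
  obtain ⟨t, htT, hmax⟩ := hTc.exists_isMaxOn ⟨0, hT0⟩ hcont.continuousOn
  have hpos : 0 < ∏ J, (Y J + t • N J).det := by
    refine lt_of_lt_of_le ?_ (hmax hT0)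
    simpa using Finset.prod_pos fun J _ => (hY J).det_pos
  have hPD : BlocksPosDef (Y + t • N) := fun J =>
    (htT J).posDef_iff_det_ne_zero.2 (Finset.prod_ne_zero_iff.1 hpos.ne' J (Finset.mem_univ J))
  have hf : ∀ s : ℝ, BlocksPosDef (Y + s • N) →
      fFW (Y + s • N) = -Real.log (∏ J, (Y J + s • N J).det) := fun s hs => by
    have h1 : ∀ J ∈ Finset.univ, (Y J + s • N J).det ≠ 0 := fun J _ => (hs J).det_pos.ne'
    rw [Real.log_prod h1]; rfl
  refine ⟨_, t, rfl, hPD, fun s hs => ?_⟩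
  rw [hf t hPD, hf s hs]
  refine neg_le_neg (Real.log_le_log (Finset.prod_pos fun J _ => (hs J).det_pos) ?_)
  exact hmax (show s ∈ T from fun J => (hs J).posSemidef)

/-- The weights `w` of `PsiDagger` lie in `[0, 1]`, so `w² ≤ w`; with `w` in place of `w²` the sum
is exactly `ip S S`, because `Psi` is adjoint to restriction. -/
theorem sum_ip_PsiDagger_le (hk : 2 ≤ k) (hkn : k ≤ n) {S : Mat n} (hS : S.IsSymm) :
    ∑ J, ip ((PsiDagger S : Blocks n k) J) ((PsiDagger S : Blocks n k) J) ≤ ip S S := by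
  have h1 : ip S S = ∑ J, ip (S.submatrix (emb J) (emb J)) ((PsiDagger S : Blocks n k) J) := by
    rw [← ip_Psi, Psi_PsiDagger hk hkn]
  rw [h1]
  refine Finset.sum_le_sum fun J _ => ?_
  rw [ip_self_eq_sum (PsiDagger_isSymm hS J)]
  simp only [ip, Matrix.trace, Matrix.diag, Matrix.mul_apply, Matrix.submatrix_apply]
  refine Finset.sum_le_sum fun p _ => Finset.sum_le_sum fun q _ => ?_
  have h2 := (PsiDagger_isSymm hS J (k := k)).apply p q
  rw [h2]
  simp only [PsiDagger]
  set w : ℝ := if p = q then 1 / ((n - 1).choose (k - 1) : ℝ) else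
    1 / ((n - 2).choose (k - 2) : ℝ) with hw
  have hw01 : 0 ≤ w ∧ w ≤ 1 := by
    have a1 : (1 : ℝ) ≤ ((n - 1).choose (k - 1) : ℝ) := by
      exact_mod_cast Nat.choose_pos (by omega)
    have a2 : (1 : ℝ) ≤ ((n - 2).choose (k - 2) : ℝ) := by
      exact_mod_cast Nat.choose_pos (by omega)
    rw [hw]
    split_ifs
    · exact ⟨by positivity, by rw [div_le_one (by linarith)]; exact a1⟩
    · exact ⟨by positivity, by rw [div_le_one (by linarith)]; exact a2⟩
  set x := S (emb J p) (emb J q)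
  have hx : 0 ≤ x ^ 2 := sq_nonneg x
  nlinarith [mul_nonneg (mul_nonneg hw01.1 (sub_nonneg.2 hw01.2)) hx]

/-- The decrement of `fFW` at `𝒴₀` dominates that of `fSDP`. -/
theorem ip_self_le_newtonDecrement_sq (hk : 2 ≤ k) (hkn : k ≤ n) (hX : StrictlyFeasible A b X)
    (hv : ip A₀ X = v) {S : Mat n} (hS : S.IsSymm) (hS0 : ip A₀ (rescale X S) = 0)
    (hSA : ∀ i, ip (A i) (rescale X S) = 0) (htr : S.trace = ip S S) :
    ip S S ≤ newtonDecrement fFW (blockSliceAt k A₀ A b v X) (Y0 n k) ^ 2 := by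
  have hC := choose_pos_cast hkn
  have hY := Y0_posDef hkn
  have hYL := Y0_mem_blockSliceAt (A₀ := A₀) hk hkn hX hv
  obtain ⟨hN, hNs, hNd, hsq⟩ := newtonStep_blockSliceAt hY hYL
  rw [hsq]
  set N := newtonStep fFW (blockSliceAt k A₀ A b v X) (Y0 n k)
  set C : ℝ := ((n - 1).choose (k - 1) : ℝ) with hCdef
  set d : Blocks n k := PsiDagger S with hd
  have hds : ∀ J, (d J).IsSymm := PsiDagger_isSymm hS
  have hinv : ∀ J, (Y0 n k J)⁻¹ = C • (1 : Mat k) := fun J => by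
    refine Matrix.inv_eq_right_inv ?_
    simp [Y0, ← hCdef, smul_smul, hC.ne']
  have hip : ∀ U W : Blocks n k, blockIp (Y0 n k) U W = C ^ 2 * ∑ J, ip (U J) (W J) := by
    intro U W
    rw [blockIp, Finset.mul_sum]
    refine Finset.sum_congr rfl fun J _ => ?_
    rw [← trace_inv_mul_inv_mul (hY J), hinv]
    simp [ip]; ring
  have hdmem : d ∈ (blockSliceAt k A₀ A b v X).direction := by
    rw [mem_blockSliceAt_direction hYL, hd, Psi_PsiDagger hk hkn]
    exact ⟨hds, hS0, hSA⟩
  -- The Newton equation of the block barrier is tested on the pulled-back direction `PsiDagger S`.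
  have hcross := hNd d hdmem
  have htrd : ∑ J, ip (Y0 n k J)⁻¹ (d J) = C * ip S S := by
    rw [← htr, ← Psi_PsiDagger hk hkn S, trace_Psi, Finset.mul_sum]
    refine Finset.sum_congr rfl fun J _ => ?_
    rw [hinv]; simp [ip, hd]
  rw [htrd, hip] at hcross
  rw [hip]
  -- Completing the square: the squared decrement is at least `2 * ip S S` minus the square sum of
  -- `d`, which is at most `ip S S`.
  have hpos : 0 ≤ ∑ J, ip (C • N J - d J) (C • N J - d J) :=
    Finset.sum_nonneg fun J _ => ip_self_nonneg (((hNs J).smul C).sub (hds J))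
  have hexp : ∑ J, ip (C • N J - d J) (C • N J - d J) =
      C ^ 2 * ∑ J, ip (N J) (N J) - 2 * C * ∑ J, ip (N J) (d J) + ∑ J, ip (d J) (d J) := by
    rw [Finset.mul_sum, Finset.mul_sum, ← Finset.sum_sub_distrib, ← Finset.sum_add_distrib]
    refine Finset.sum_congr rfl fun J _ => ?_
    rw [ip_sub, ip_smul, ip_comm _ (N J), ip_comm _ (d J), ip_sub, ip_sub, ip_smul, ip_smul,
      ip_comm (d J) (N J)]
    ring
  have hdd := sum_ip_PsiDagger_le hk hkn hS
  have hcross' : C * ∑ J, ip (N J) (d J) = ip S S := by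
    have : C * (C * ∑ J, ip (N J) (d J)) = C * ip S S := by rw [← hcross]; ring
    exact mul_left_cancel₀ hC.ne' this
  rw [hexp] at hpos
  linarith

/-- Both matrix decrements are Frobenius norms of a rescaled Newton step `S`. The Newton equation
tested on the step itself gives `S.trace = ip S S`, the form in which the block decrement dominates.
-/
theorem newtonDecrement_fSDP_le (hk : 2 ≤ k) (hkn : k ≤ n) (hX : StrictlyFeasible A b X)
    (hv : ip A₀ X = v)
    (hΔ : newtonDecrement fFW (blockSliceAt k A₀ A b v X) (Y0 n k) ≤ 1 / 14) :
    newtonDecrement fSDP (slice A₀ A b v) X ≤ 1 / 9 ∧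
      newtonDecrement fSDP (sliceAt A₀ A b v X) 1 ≤ 1 / 9 := by
  have hbound : ∀ S : Mat n, S.IsSymm → ip A₀ (rescale X S) = 0 →
      (∀ i, ip (A i) (rescale X S) = 0) → S.trace = ip S S → Real.sqrt (ip S S) ≤ 1 / 9 := by
    intro S hS h0 hA htr
    have h1 := ip_self_le_newtonDecrement_sq hk hkn hX hv hS h0 hA htr
    have h2 : Real.sqrt (ip S S) ≤ newtonDecrement fFW (blockSliceAt k A₀ A b v X) (Y0 n k) := by
      exact (Real.sqrt_le_left (show 0 ≤ newtonDecrement fFW _ _ from Real.sqrt_nonneg _)).2 h1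
    linarith
  constructor
  · have hmem := hX.mem_slice hv
    obtain ⟨hN, hNd⟩ := newtonStep_fSDP hX.1 (slice A₀ A b v)
      (fun d hd => ((mem_slice_direction hmem).1 hd).1)
    obtain ⟨hNs, hN0, hNA⟩ := (mem_slice_direction hmem).1 hN
    rw [newtonDecrement, hess_fSDP_eq hX.1]
    refine hbound _ (unscale_isSymm X hNs) ?_ ?_ ?_
    · rwa [rescale_unscale hX.1]
    · rwa [rescale_unscale hX.1]
    · rw [hNd _ hN, ip_inv_eq_trace_unscale hX.1]
  · have hmem := hX.one_mem_sliceAt hv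
    have hone : (1 : Mat n).PosDef := Matrix.PosDef.one
    obtain ⟨hN, hNd⟩ := newtonStep_fSDP hone (sliceAt A₀ A b v X)
      (fun d hd => ((mem_slice_direction hmem).1 hd).1)
    obtain ⟨hNs, hN0, hNA⟩ := (mem_slice_direction hmem).1 hN
    have hun : ∀ B : Mat n, unscale 1 B = B := fun B => by simp [unscale, CFC.sqrt_one]
    have hNN := hNd _ hN
    rw [hun, inv_one, ip_one_left] at hNN
    rw [newtonDecrement, hess_fSDP_eq hone, hun]
    refine hbound _ hNs ?_ ?_ hNN.symm
    · rwa [ip_rescale]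
    · intro i; rw [ip_rescale]; exact hNA i

/-- Invariants of a corrector phase, with the potential `C fSDP(X) + fFW(𝒴) - fFW(𝒴₀)`. -/
theorem CorrectorRun.invariant {r : ℕ} (hk : 2 ≤ k) (hr : 0 < r) (hn : n = k * r) {X₂ : Mat n}
    (hX₂ : StrictlyFeasible A b X₂) (hv : ip A₀ X₂ = v) {Y : Blocks n k} {N : ℕ}
    (h : CorrectorRun k A₀ A b v X₂ X Y N) :
    (StrictlyFeasible A b X ∧ ip A₀ X = v) ∧
      (BlocksPosDef Y ∧ Y ∈ blockSliceAt k A₀ A b v X) ∧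
      (N : ℝ) / 800 + (((n - 1).choose (k - 1) : ℝ) * fSDP X + (fFW Y - fFW (Y0 n k))) ≤
        ((n - 1).choose (k - 1) : ℝ) * fSDP X₂ := by
  have hkn : k ≤ n := hn ▸ Nat.le_mul_of_pos_right k hr
  induction h with
  | start => exact ⟨⟨hX₂, hv⟩, ⟨Y0_posDef hkn, Y0_mem_blockSliceAt hk hkn hX₂ hv⟩, by simp⟩
  | lineSearch _ hΔ hls ih =>
    obtain ⟨hX, ⟨hY, hYL⟩, hpot⟩ := ih
    obtain ⟨t, rfl, hY', hmin⟩ := hls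
    obtain ⟨s, hs, hdec⟩ := exists_decrease hY hYL hΔ
    refine ⟨hX, ⟨hY', ?_⟩, ?_⟩
    · rw [add_comm]
      exact AffineSubspace.vadd_mem_of_mem_direction
        (Submodule.smul_mem _ t (newtonStep_blockSliceAt hY hYL).1) hYL
    -- The exact minimizer on the line is at least as good as the damped step.
    · have := hmin s hs
      push_cast
      linarith
  | rescaling _ ih =>
    obtain ⟨⟨hX, hXv⟩, ⟨hY, hYL⟩, hpot⟩ := ih
    have hP := Psi_posDef hk hkn hY
    rw [mem_blockSliceAt] at hYL
    have hX' := (rescale_posDef hX.1).2 hP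
    refine ⟨⟨⟨hX', hYL.2.2⟩, hYL.2.1⟩, ⟨Y0_posDef hkn,
      Y0_mem_blockSliceAt hk hkn ⟨hX', hYL.2.2⟩ hYL.2.1⟩, ?_⟩
    -- Rescaling adds `C * fSDP (Psi Y)` and removes `fFW Y - fFW (Y0 n k)`.
    have h1 := fSDP_Psi_le hk hr hn hY
    rw [fSDP] at h1
    rw [fSDP] at hpot
    rw [fSDP, det_rescale hX.1, Real.log_mul hX.1.det_pos.ne' hP.det_pos.ne']
    linarith

/-- The potential bounds the number of line searches. -/
theorem CorrectorRun.count_le {r : ℕ} (hk : 2 ≤ k) (hr : 0 < r) (hn : n = k * r) {X₂ : Mat n}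
    (hX₂ : StrictlyFeasible A b X₂) (hv : ip A₀ X₂ = v) {η : ℝ} {z : Mat n}
    (hz : IsCentralPoint A₀ A b η z) (hvz : v ≤ ip A₀ z) {Y : Blocks n k} {N : ℕ}
    (h : CorrectorRun k A₀ A b v X₂ X Y N) :
    (N : ℝ) ≤ 800 * ((n - 1).choose (k - 1) : ℝ) * (fSDP X₂ - fSDP z) := by
  -- A further rescaling costs no line search and makes the block part of the potential vanish.
  obtain ⟨⟨hX, hXv⟩, -, hpot⟩ := (CorrectorRun.rescaling h).invariant hk hr hn hX₂ hv
  have h1 := hz.fSDP_le hX (hXv.le.trans hvz)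
  have h2 : (0 : ℝ) ≤ ((n - 1).choose (k - 1) : ℝ) := Nat.cast_nonneg _
  nlinarith [mul_le_mul_of_nonneg_left h1 h2]

end Corrector

end FactorWidth

end

/-! ### Assembly of the predictor and corrector estimates. -/

theorem mainTheorem5 {n k m : ℕ} (hn : 0 < n) (hk : 2 ≤ k) (hkn : k ∣ n)
    (A₀ : FactorWidth.Mat n) (A : Fin m → FactorWidth.Mat n)
    (hA₀ : A₀.IsSymm) (hA : ∀ i, (A i).IsSymm) (b : Fin m → ℝ)
    (σ : ℝ) (hσ0 : 0 < σ) (hσ1 : σ < 1)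
    (X₁ X₂ : FactorWidth.Mat n) (hX₁ : FactorWidth.StrictlyFeasible A b X₁)
    (hcentral : ∃ η z, FactorWidth.IsCentralPoint A₀ A b η z ∧
      FactorWidth.ip A₀ z = FactorWidth.ip A₀ X₁)
    (hclose : FactorWidth.newtonDecrement FactorWidth.fSDP
      (FactorWidth.slice A₀ A b (FactorWidth.ip A₀ X₁)) X₁ ≤ 1 / 9)
    (hpred : FactorWidth.IsPredictorStep k A₀ A σ X₁ X₂)
    (v₂ : ℝ) (hv₂ : v₂ = FactorWidth.ip A₀ X₂)
    (K : ℕ) (hK : K = ⌈2688 * ((n - 1).choose (k - 1) : ℝ) *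
      ((n : ℝ) * Real.log (1 / (1 - σ)) + 1 / 154)⌉₊) :
    -- the target on the central path exists
    (∃ η z, FactorWidth.IsCentralPoint A₀ A b η z ∧ FactorWidth.ip A₀ z = v₂) ∧
    -- whatever the rescaling policy, every corrector phase makes at most `K` line searches, never
    -- gets stuck, and is close to the central path once its stopping test is met
    (∀ X Y N, FactorWidth.CorrectorRun k A₀ A b v₂ X₂ X Y N →
      N ≤ K ∧
      FactorWidth.StrictlyFeasible A b X ∧ FactorWidth.ip A₀ X = v₂ ∧
      (1 / 14 < FactorWidth.newtonDecrement FactorWidth.fFW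
          (FactorWidth.blockSliceAt k A₀ A b v₂ X) Y →
        ∃ Y', FactorWidth.IsLineSearch (FactorWidth.blockSliceAt k A₀ A b v₂ X) Y Y') ∧
      (FactorWidth.newtonDecrement FactorWidth.fFW
          (FactorWidth.blockSliceAt k A₀ A b v₂ X) (FactorWidth.Y0 n k) ≤ 1 / 14 →
        FactorWidth.newtonDecrement FactorWidth.fSDP
            (FactorWidth.slice A₀ A b v₂) X ≤ 1 / 9 ∧
        FactorWidth.newtonDecrement FactorWidth.fSDP
            (FactorWidth.sliceAt A₀ A b v₂ X) 1 ≤ 1 / 9)) ∧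
    -- hence a point at which the next predictor step can be taken is found within `K` line searches
    (∃ X N, FactorWidth.CorrectorRun k A₀ A b v₂ X₂ X (FactorWidth.Y0 n k) N ∧ N ≤ K ∧
      FactorWidth.newtonDecrement FactorWidth.fFW
        (FactorWidth.blockSliceAt k A₀ A b v₂ X) (FactorWidth.Y0 n k) ≤ 1 / 14 ∧
      FactorWidth.newtonDecrement FactorWidth.fSDP (FactorWidth.slice A₀ A b v₂) X ≤ 1 / 9) := by
  obtain ⟨r, hn'⟩ := hkn
  have hr : 0 < r := Nat.pos_of_ne_zero fun h => by simp [h] at hn'; omega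
  have hkn : k ≤ n := hn' ▸ Nat.le_mul_of_pos_right k hr
  obtain ⟨η, z, hz, hzv⟩ := hcentral
  obtain ⟨hX₂, hle, hpot⟩ :=
    FactorWidth.predictor_spec hk hkn hA₀ hA hσ0 hσ1 hX₁ hz hzv hpred
  have hle' : v₂ ≤ FactorWidth.ip A₀ z := by rw [hv₂, hzv]; exact hle
  have hclose' := FactorWidth.fSDP_sub_le hX₁ hz.2.1 hzv hclose
  have hcount : ∀ X Y N, FactorWidth.CorrectorRun k A₀ A b v₂ X₂ X Y N → N ≤ K := by
    intro X Y N h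
    have h1 := h.count_le hk hr hn' hX₂ hv₂.symm hz hle'
    have h2 : 0 ≤ Real.log (1 / (1 - σ)) := by
      refine Real.log_nonneg ?_
      rw [le_div_iff₀ (by linarith)]; linarith
    have h3 : FactorWidth.fSDP X₂ - FactorWidth.fSDP z ≤
        (n : ℝ) * Real.log (1 / (1 - σ)) + 1 / 81 := by linarith
    have h4 : (0 : ℝ) ≤ ((n - 1).choose (k - 1) : ℝ) := Nat.cast_nonneg _
    have h5 : (0 : ℝ) ≤ (n : ℝ) * Real.log (1 / (1 - σ)) := mul_nonneg (Nat.cast_nonneg _) h2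
    -- The bound proved is sharper: `800 ≤ 2688` and `800/81 ≤ 2688/154`.
    have h6 : (N : ℝ) ≤ 2688 * ((n - 1).choose (k - 1) : ℝ) *
        ((n : ℝ) * Real.log (1 / (1 - σ)) + 1 / 154) := by
      refine h1.trans ?_
      rw [mul_assoc, mul_assoc, mul_left_comm, mul_left_comm (2688 : ℝ)]
      refine mul_le_mul_of_nonneg_left ?_ h4
      linarith
    rw [hK]
    exact_mod_cast h6.trans (Nat.le_ceil _)
  refine ⟨?_, ?_, ?_⟩
  · rw [hv₂]
    exact FactorWidth.exists_isCentralPoint hz hX₂ (hv₂ ▸ hle')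
  · intro X Y N h
    obtain ⟨⟨hX, hXv⟩, ⟨hY, hYL⟩, -⟩ := h.invariant hk hr hn' hX₂ hv₂.symm
    exact ⟨hcount X Y N h, hX, hXv, FactorWidth.exists_isLineSearch hz hX.1 hY hYL,
      FactorWidth.newtonDecrement_fSDP_le hk hkn hX hXv⟩
  · by_contra hcon
    -- If the stopping test never held, alternating searches and rescalings would continue forever,
    -- contradicting the bound at `K + 1`.
    have hrun : ∀ N : ℕ, ∃ X,
        FactorWidth.CorrectorRun k A₀ A b v₂ X₂ X (FactorWidth.Y0 n k) N := by
      intro N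
      induction N with
      | zero => exact ⟨X₂, FactorWidth.CorrectorRun.start⟩
      | succ N ih =>
        obtain ⟨X, h⟩ := ih
        obtain ⟨⟨hX, hXv⟩, ⟨hY, hYL⟩, -⟩ := h.invariant hk hr hn' hX₂ hv₂.symm
        have hΔ : 1 / 14 < FactorWidth.newtonDecrement FactorWidth.fFW
            (FactorWidth.blockSliceAt k A₀ A b v₂ X) (FactorWidth.Y0 n k) := by
          by_contra hΔ
          exact hcon ⟨X, N, h, hcount _ _ _ h, not_lt.1 hΔ,
            (FactorWidth.newtonDecrement_fSDP_le hk hkn hX hXv (not_lt.1 hΔ)).1⟩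
        obtain ⟨Y', hY'⟩ := FactorWidth.exists_isLineSearch hz hX.1 hY hYL hΔ
        exact ⟨_, (h.lineSearch hΔ hY').rescaling⟩
    obtain ⟨X, h⟩ := hrun (K + 1)
    have := hcount _ _ _ h
    omega
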